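/- Conventions. All graphs are finite and simple; $\Delta(G)$, $\delta(G)$ denote the maximum and minimum degree. A graph $G$ is $K$-almost-regular if $\Delta(G)\le K\delta(G)$. It is $(c,t)$-sparse if $e(A,B)\le(1-c)|A||B|$ for all (not necessarily disjoint) $A,B\subseteq V(G)$ with $|A|,|B|\ge t$, where $e(A,B)$ is the number of pairs $(a,b)\in A\times B$ with $ab\in E(G)$. An $s$-path is a path with $s$ edges; paths are counted as subgraphs, without orientation. For fixed reals $L,t>0$, admissible and good paths are defined recursively: every path of length one is both admissible and good; for $s\ge2$, an induced $s$-path is admissible if both of its $(s-1)$-subpaths are good, and it is good if it is admissible and the number of admissible $s$-paths with the same endpoints (itself included) is at most $(Lt)^{s-1}$. An induced path is bad if it is not good. Lemma 3.4. There are increasing (i.e. nondecreasing) functions $f_1,f_2,f_3:(0,\infty)\to(0,\infty)$ and a function $f_4:(0,\infty)^2\to(0,\infty)$, increasing in each variable, such that the following holds. Let $C,L,\beta,\varepsilon,K>0$ be reals and $\ell\ge1$ an integer with $$\tfrac1C\le f_1\!\left(\tfrac1L\right),\qquad \tfrac1L\le f_2\!\left(\tfrac1\beta\right),\qquad \tfrac1\beta\le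 f_3(\varepsilon),\qquad \varepsilon\le f_4\!\left(\tfrac1K,\tfrac1\ell\right)$$ (that is, $1/C\ll1/L\ll1/\beta\ll\varepsilon\ll1/K,1/\ell$). Let $t>0$ be real and let $G$ be an $n$-vertex $K$-almost-regular and $(1-\varepsilon,\beta t)$-sparse graph with average degree $d\ge 2Ct$. If for some integer $s$ with $2\le s\le\ell$ the number of bad admissible $s$-paths in $G$ (with respect to $L$ and $t$) is at least $$\frac12\left(\frac1{4K}\right)^{2\ell-s}n\,d^s,$$ then $G$ contains an induced copy of the cycle $C_{2\ell}$. -/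

import Mathlib

/-- `G` is `K`-almost-regular: `Δ(G) ≤ K δ(G)`. -/
def IsAlmostRegular {V : Type*} [Fintype V] (G : SimpleGraph V) [DecidableRel G.Adj]
    (K : ℝ) : Prop :=
  (G.maxDegree : ℝ) ≤ K * (G.minDegree : ℝ)

/-- `G` is `(c, t)`-sparse: `e(A, B) ≤ (1 - c)|A||B|` for all (not necessarily disjoint) vertex
sets `A, B` with `|A|, |B| ≥ t`. Here `e(A, B)` is the number of ordered pairs `(a, b) ∈ A × B`
with `a` adjacent to `b`, which is the cardinality of `G.interedges A B`. -/
def IsLocallySparse {V : Type*} (G : SimpleGraph V) [DecidableRel G.Adj] (c t : ℝ) : Prop :=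
  ∀ A B : Finset V, t ≤ (A.card : ℝ) → t ≤ (B.card : ℝ) →
    ((G.interedges A B).card : ℝ) ≤ (1 - c) * (A.card : ℝ) * (B.card : ℝ)

/-- The average degree `d(G)`. -/
noncomputable def averageDegree {V : Type*} [Fintype V] (G : SimpleGraph V)
    [DecidableRel G.Adj] : ℝ :=
  (∑ v, (G.degree v : ℝ)) / (Fintype.card V : ℝ)

/-- The vertex sequence `p 0, p 1, …, p s` traverses an induced path of length `s` in `G`: the
vertices are distinct, and two of them are adjacent exactly when they are consecutive. -/
def IsInducedPath {V : Type*} (G : SimpleGraph V) {s : ℕ} (p : Fin (s + 1) → V) : Prop :=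
  Function.Injective p ∧
    ∀ i j : Fin (s + 1), G.Adj (p i) (p j) ↔ (SimpleGraph.pathGraph (s + 1)).Adj i j

/-- Goodness of an `s`-path, relative to a notion `Adm` of admissible `s`-path: every path of
length one is good, and for `s ≠ 1` the path `p` is good if it is admissible and the number of
admissible `s`-paths with the same endpoints as `p` (`p` included) is at most `(L t) ^ (s - 1)`.
An `s`-path between two distinct vertices `u` and `v` has exactly one traversal from `u` to `v`,
so these paths are counted by their traversals from `p 0` to `p s`. -/
def IsGoodWrt {V : Type*} (L t : ℝ) (s : ℕ) (Adm : (Fin (s + 1) → V) → Prop)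
    (p : Fin (s + 1) → V) : Prop :=
  Adm p ∧ (s = 1 ∨
    (({q : Fin (s + 1) → V | Adm q ∧ q 0 = p 0 ∧ q (Fin.last s) = p (Fin.last s)}.ncard : ℕ) : ℝ)
      ≤ (L * t) ^ (s - 1))

/-- Admissible `s`-paths (given by a traversal `p`), with parameters `L` and `t`. Every path of
length one is admissible. For `s ≥ 2`, an `s`-path is admissible if it is induced and its two
`(s - 1)`-subpaths, obtained by deleting the last or the first vertex, are good. Only lengths
`s ≥ 1` are meaningful. -/
def IsAdmissible {V : Type*} (G : SimpleGraph V) (L t : ℝ) :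
    (s : ℕ) → (Fin (s + 1) → V) → Prop
  | 0, _ => False
  | 1, p => G.Adj (p 0) (p 1)
  | s + 2, p => IsInducedPath G p ∧
      IsGoodWrt L t (s + 1) (IsAdmissible G L t (s + 1)) (fun i => p i.castSucc) ∧
      IsGoodWrt L t (s + 1) (IsAdmissible G L t (s + 1)) (fun i => p i.succ)

/-- Good `s`-paths (given by a traversal `p`), with parameters `L` and `t`. -/
def IsGood {V : Type*} (G : SimpleGraph V) (L t : ℝ) (s : ℕ) (p : Fin (s + 1) → V) : Prop :=
  IsGoodWrt L t s (IsAdmissible G L t s) p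

/-- The set of bad (that is, not good) admissible `s`-paths of `G`. Paths are subgraphs of `G`
here, so a path and its reversal are counted once; as an admissible path is induced, it is the
induced subgraph of `G` on its vertex set. -/
def badAdmissiblePaths {V : Type*} (G : SimpleGraph V) (L t : ℝ) (s : ℕ) : Set G.Subgraph :=
  {P | ∃ p : Fin (s + 1) → V, IsAdmissible G L t s p ∧ ¬ IsGood G L t s p ∧
    P = (⊤ : G.Subgraph).induce (Set.range p)}

/-- A function that may witness a relation `x ≪ y`, read as `x ≤ f y`: it is increasing and
positive on the positive reals. -/
def IsHierarchyFun (f : ℝ → ℝ) : Prop :=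
  MonotoneOn f (Set.Ioi 0) ∧ ∀ y : ℝ, 0 < y → 0 < f y

/-- A function that may witness a relation `x ≪ y, z`, read as `x ≤ f y z`: it is increasing in
each variable and positive on the positive reals. -/
def IsHierarchyFun₂ (f : ℝ → ℝ → ℝ) : Prop :=
  (∀ y y' z z' : ℝ, 0 < y → y ≤ y' → 0 < z → z ≤ z' → f y z ≤ f y' z') ∧
    ∀ y z : ℝ, 0 < y → 0 < z → 0 < f y z

/-!
The induced cycle is found as a random closed walk. Given the part of the walk between two of its
vertices, these are independent and each is spread over more than `β * t` vertices, so that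
sparseness makes all chords unlikely.

The mechanism is `cycleGraph_isIndContained_of_isSpread`. A state consists of an induced path of
length `r` from a fixed base vertex to an endpoint `p`, and a neighbour `q` of `p`. A Markov chain
on the states alternately keeps `p` and keeps `q`, resampling the rest uniformly. Both kinds of
steps preserve the uniform distribution and are reversible, so any two times of the chain are
independent and uniform in their classes when seen from states in between
(`sum_chainWeight_pair_le`). The vertices `p, q, p', q', …` kept in the successive steps form a
walk, which the paths of the first and the last state close to a cycle of length `2 * r + 2 * j`.
If resampling gives each vertex with small probability, then any chord of this cycle appears with
probability little more than `ε` (`card_pairs_inConflict_le`), and a union bound over the pairs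
finishes the argument.

It remains to find a suitable family of states. For `s ≥ 3` they are the bad admissible `s`-paths
from a vertex `u` with many such paths; `q` is the penultimate vertex. There are more than
`(L * t) ^ (s - 1)` of them to each endpoint, but by goodness of the proper subpaths only
`(L * t) ^ (s - 2)` of these pass through a given vertex at a given position
(`ncard_admissible_through_le`). Paths with few extensions at their last vertex are negligible as
`d` is much larger than `L * t`, and are deleted by `exists_subset_card_fiber_ge`.

For `s = 2` the penultimate vertices are adjacent to `u`, and another family is needed. Some vertex
`m` is the middle of many bad `2`-paths, so a positive proportion of the pairs of its neighbours are
linked, that is, nonadjacent with more than `L * t` common neighbours. The base vertex `b` and the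
vertices `p` are chosen among the neighbours of `m`, with `p` linked to `b`, and `q` among the
vertices adjacent to many of these neighbours (`cycleGraph_isIndContained_of_linked`). The vertex
`m` itself need not lie on the cycle.
-/

open Finset

/-! ### Sparseness for spread distributions -/

/-- If `g ≤ θ` outside a set of at most `τ` vertices and no vertex is hit by `x` with probability
more than `1 / M`, then the average of `g ∘ x` is at most `θ + τ / M`. -/
theorem sum_le_of_card_exceptional_le {V Ω : Type*} [Fintype V] [DecidableEq V]
    (C : Finset Ω) (x : Ω → V)
    {M θ τ : ℝ} (hM : 0 < M) (hθ : 0 ≤ θ)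
    (hx : ∀ z, M * (#{α ∈ C | x α = z} : ℝ) ≤ #C) (g : V → ℝ) (hg : ∀ z, g z ≤ 1)
    (A : Finset V) (hA : (#A : ℝ) ≤ τ) (hAg : ∀ z ∉ A, g z ≤ θ) :
    ∑ α ∈ C, g (x α) ≤ (θ + τ / M) * #C := by
  have h1 : ∑ α ∈ C, g (x α) ≤ ∑ α ∈ C, (θ + if x α ∈ A then 1 else 0) := by
    refine sum_le_sum fun α _ => ?_
    split_ifs with h
    · linarith [hg (x α)]
    · linarith [hAg _ h]
  have h2 : ((#{α ∈ C | x α ∈ A} : ℕ) : ℝ) ≤ τ / M * #C := by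
    have h3 : #{α ∈ C | x α ∈ A} = ∑ z ∈ A, #{α ∈ C | x α = z} := by
      rw [card_eq_sum_card_fiberwise (f := x) (t := A) (fun α hα => by simpa using (by
        simpa using hα : α ∈ C ∧ x α ∈ A).2)]
      refine sum_congr rfl fun z hz => ?_
      congr 1
      ext α
      simp only [mem_filter]
      constructor
      · rintro ⟨⟨h, _⟩, h'⟩
        exact ⟨h, h'⟩
      · rintro ⟨h, h'⟩
        exact ⟨⟨h, h' ▸ hz⟩, h'⟩
    rw [h3]
    push_cast
    calc ∑ z ∈ A, (#{α ∈ C | x α = z} : ℝ) ≤ ∑ z ∈ A, (#C : ℝ) / M := by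
          refine sum_le_sum fun z _ => ?_
          rw [le_div_iff₀ hM]
          linarith [hx z]
      _ = #A * ((#C : ℝ) / M) := by simp
      _ ≤ τ * ((#C : ℝ) / M) := by gcongr
      _ = τ / M * #C := by ring
  rw [sum_add_distrib] at h1
  simp only [sum_const, nsmul_eq_mul, sum_boole] at h1
  linarith

/-- Local sparseness passes from sets of vertices to spread distributions: if independent random
vertices `x α` and `y β` take each value with probability at most `1 / M`, then they are adjacent
with probability at most `ε + 2 * τ / M`. -/
theorem card_pairs_adj_le {V Ω₁ Ω₂ : Type*} [Fintype V] [DecidableEq V] (G : SimpleGraph V)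
    [DecidableRel G.Adj] {ε τ M : ℝ} (hG : IsLocallySparse G (1 - ε) τ) (hε : 0 ≤ ε) (hτ : 0 < τ)
    (hM : 0 < M) (C₁ : Finset Ω₁) (C₂ : Finset Ω₂) (x : Ω₁ → V) (y : Ω₂ → V)
    (hx : ∀ z, M * (#{α ∈ C₁ | x α = z} : ℝ) ≤ #C₁)
    (hy : ∀ z, M * (#{α ∈ C₂ | y α = z} : ℝ) ≤ #C₂) :
    ∑ β ∈ C₂, (#{α ∈ C₁ | G.Adj (x α) (y β)} : ℝ) ≤ (ε + 2 * τ / M) * #C₁ * #C₂ := by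
  rcases C₁.eq_empty_or_nonempty with rfl | hne
  · simp
  have hC : (0 : ℝ) < #C₁ := by exact_mod_cast hne.card_pos
  set θ := ε + τ / M with hθ
  have hθ0 : 0 ≤ θ := by positivity
  -- few vertices are joined to more than a proportion `ε` of a given large set
  have step : ∀ B : Finset V, τ ≤ #B →
      ∑ z ∈ B, (#{α ∈ C₁ | G.Adj (x α) z} : ℝ) ≤ θ * #C₁ * #B := by
    intro B hB
    have hB0 : (0 : ℝ) < #B := lt_of_lt_of_le hτ hB
    have hcount : ∀ A : Finset V,
        (#(G.interedges A B) : ℝ) = ∑ a ∈ A, (#{z ∈ B | G.Adj a z} : ℝ) := by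
      intro A
      rw [SimpleGraph.interedges, Rel.interedges, card_filter, sum_product]
      push_cast
      refine sum_congr rfl fun a _ => ?_
      rw [card_filter]
      push_cast
      rfl
    let A : Finset V := {a | ε * #B < #{z ∈ B | G.Adj a z}}
    have hA : (#A : ℝ) ≤ τ := by
      by_contra! h
      have h1 := hG A B h.le hB
      rw [hcount] at h1
      have hApos : (0 : ℝ) < #A := hτ.trans h
      have h2 : ∑ a ∈ A, ε * (#B : ℝ) < ∑ a ∈ A, (#{z ∈ B | G.Adj a z} : ℝ) := by
        refine sum_lt_sum_of_nonempty (card_pos.1 (by exact_mod_cast hApos)) fun a ha => ?_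
        exact (mem_filter.1 ha).2
      simp only [sum_const, nsmul_eq_mul] at h2
      linarith
    have h := sum_le_of_card_exceptional_le C₁ x hM hε hx
      (fun a => (#{z ∈ B | G.Adj a z} : ℝ) / #B)
      (fun a => by
        rw [div_le_one hB0]
        exact_mod_cast card_filter_le _ _) A hA
      (fun a ha => by
        rw [div_le_iff₀ hB0]
        simpa [A] using ha)
    rw [← sum_div, div_le_iff₀ hB0] at h
    have h3 : ∑ z ∈ B, (#{α ∈ C₁ | G.Adj (x α) z} : ℝ)
        = ∑ α ∈ C₁, (#{z ∈ B | G.Adj (x α) z} : ℝ) := by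
      simp only [card_filter]
      push_cast
      exact sum_comm
    rw [h3]
    exact h
  -- hence few vertices `z` are adjacent to `x α` for more than a proportion `θ` of the `α`
  let B : Finset V := {z | θ * #C₁ < #{α ∈ C₁ | G.Adj (x α) z}}
  have hB : (#B : ℝ) ≤ τ := by
    by_contra! h
    have h1 := step B h.le
    have hBpos : (0 : ℝ) < #B := hτ.trans h
    have h2 : ∑ a ∈ B, θ * (#C₁ : ℝ) < ∑ z ∈ B, (#{α ∈ C₁ | G.Adj (x α) z} : ℝ) := by
      refine sum_lt_sum_of_nonempty (card_pos.1 (by exact_mod_cast hBpos)) fun a ha => ?_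
      exact (mem_filter.1 ha).2
    simp only [sum_const, nsmul_eq_mul] at h2
    linarith
  have h := sum_le_of_card_exceptional_le C₂ y hM hθ0 hy
      (fun z => (#{α ∈ C₁ | G.Adj (x α) z} : ℝ) / #C₁)
      (fun a => by
        rw [div_le_one hC]
        exact_mod_cast card_filter_le _ _) B hB
      (fun a ha => by
        rw [div_le_iff₀ hC]
        simpa [B] using ha)
  rw [← sum_div, div_le_iff₀ hC] at h
  calc _ ≤ _ := h
    _ = _ := by rw [hθ]; ring

/-- Two vertices are in conflict if they coincide or are adjacent. -/
def InConflict {V : Type*} (G : SimpleGraph V) (v w : V) : Prop := v = w ∨ G.Adj v w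

open Classical in
theorem card_pairs_inConflict_le {V Ω₁ Ω₂ : Type*} [Fintype V] (G : SimpleGraph V)
    [DecidableRel G.Adj] {ε τ M : ℝ} (hG : IsLocallySparse G (1 - ε) τ) (hε : 0 ≤ ε) (hτ : 0 < τ)
    (hM : 0 < M) (C₁ : Finset Ω₁) (C₂ : Finset Ω₂) (x : Ω₁ → V) (y : Ω₂ → V)
    (hx : ∀ z, M * (#{α ∈ C₁ | x α = z} : ℝ) ≤ #C₁)
    (hy : ∀ z, M * (#{α ∈ C₂ | y α = z} : ℝ) ≤ #C₂) :
    ∑ β ∈ C₂, (#{α ∈ C₁ | InConflict G (x α) (y β)} : ℝ)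
      ≤ (ε + 2 * τ / M + 1 / M) * #C₁ * #C₂ := by
  have h1 := card_pairs_adj_le G hG hε hτ hM C₁ C₂ x y hx hy
  have h2 : ∑ β ∈ C₂, (#{α ∈ C₁ | x α = y β} : ℝ) ≤ 1 / M * #C₁ * #C₂ := by
    calc _ ≤ ∑ β ∈ C₂, (1 / M * #C₁ : ℝ) := by
          refine sum_le_sum fun β _ => ?_
          rw [one_div, ← div_eq_inv_mul, le_div_iff₀ hM]
          linarith [hx (y β)]
      _ = _ := by simp; ring
  have h3 : ∑ β ∈ C₂, (#{α ∈ C₁ | InConflict G (x α) (y β)} : ℝ) ≤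
      ∑ β ∈ C₂, (#{α ∈ C₁ | x α = y β} : ℝ) + ∑ β ∈ C₂, (#{α ∈ C₁ | G.Adj (x α) (y β)} : ℝ) := by
    rw [← sum_add_distrib]
    refine sum_le_sum fun β _ => ?_
    have := card_union_le {α ∈ C₁ | x α = y β} {α ∈ C₁ | G.Adj (x α) (y β)}
    have h4 : ({α ∈ C₁ | InConflict G (x α) (y β)} : Finset Ω₁) =
        {α ∈ C₁ | x α = y β} ∪ {α ∈ C₁ | G.Adj (x α) (y β)} := by
      ext α
      simp only [mem_filter, mem_union]
      unfold InConflict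
      tauto
    rw [h4]
    exact_mod_cast this
  nlinarith

/-! ### Chains that resample uniformly within classes -/

/-- The transition matrix of "resample the state uniformly within its class", the classes being
the fibres of `key`. -/
noncomputable def resample {Ω A : Type*} [Fintype Ω] [DecidableEq A] (key : Ω → A) :
    Matrix Ω Ω ℝ :=
  fun ω ω' => if key ω' = key ω then ((#{α | key α = key ω} : ℕ) : ℝ)⁻¹ else 0

/-- A symmetric idempotent matrix with nonnegative entries and row sums `1`. -/
structure IsAveraging {Ω : Type*} [Fintype Ω] (T : Matrix Ω Ω ℝ) : Prop where
  nonneg : ∀ ω ω', 0 ≤ T ω ω'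
  symm : ∀ ω ω', T ω ω' = T ω' ω
  sum_row : ∀ ω, ∑ ω', T ω ω' = 1
  idem : T * T = T

theorem card_class_pos {Ω A : Type*} [Fintype Ω] [DecidableEq A] (key : Ω → A) (ω : Ω) :
    0 < #{α | key α = key ω} :=
  card_pos.2 ⟨ω, by simp⟩

theorem sum_resample_mul {Ω A : Type*} [Fintype Ω] [DecidableEq A] (key : Ω → A) (ω : Ω)
    (f : Ω → ℝ) :
    ∑ ω', resample key ω ω' * f ω' = (∑ ω' with key ω' = key ω, f ω') / #{α | key α = key ω} := by
  simp only [resample, ite_mul, zero_mul]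
  rw [← sum_filter, ← mul_sum, div_eq_inv_mul]

theorem isAveraging_resample {Ω A : Type*} [Fintype Ω] [DecidableEq A] (key : Ω → A) :
    IsAveraging (resample key) where
  nonneg ω ω' := by
    unfold resample
    split_ifs <;> positivity
  symm ω ω' := by
    unfold resample
    by_cases h : key ω' = key ω
    · simp [h]
    · rw [if_neg h, if_neg (Ne.symm h)]
  sum_row ω := by
    have := sum_resample_mul key ω (fun _ => 1)
    have h := card_class_pos key ω
    simp only [mul_one, sum_const, nsmul_eq_mul] at this
    rw [this, div_self (by positivity)]
  idem := by
    ext ω ω'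
    rw [Matrix.mul_apply, sum_resample_mul]
    have h := card_class_pos key ω
    have : ∀ α ∈ ({α | key α = key ω} : Finset Ω), resample key α ω' = resample key ω ω' := by
      intro α hα
      simp only [mem_filter, mem_univ, true_and] at hα
      simp only [resample, hα]
    rw [sum_congr rfl this, sum_const, nsmul_eq_mul]
    field_simp

/-- The weight of a trajectory of the time-inhomogeneous chain with transition matrices `T k`,
started from the counting measure. -/
noncomputable def chainWeight {Ω : Type*} (T : ℕ → Matrix Ω Ω ℝ) {n : ℕ}
    (c : Fin (n + 1) → Ω) : ℝ :=
  ∏ k : Fin n, T k (c k.castSucc) (c k.succ)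

/-- The product `T a * T (a + 1) * ⋯ * T (a + m - 1)`. -/
noncomputable def chainProd {Ω : Type*} [Fintype Ω] [DecidableEq Ω] (T : ℕ → Matrix Ω Ω ℝ)
    (a m : ℕ) : Matrix Ω Ω ℝ :=
  ((List.range m).map fun i => T (a + i)).prod

theorem chainProd_zero {Ω : Type*} [Fintype Ω] [DecidableEq Ω]
    (T : ℕ → Matrix Ω Ω ℝ) (a : ℕ) : chainProd T a 0 = 1 := rfl

theorem chainProd_succ {Ω : Type*} [Fintype Ω] [DecidableEq Ω] (T : ℕ → Matrix Ω Ω ℝ) (a m : ℕ) :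
    chainProd T a (m + 1) = chainProd T a m * T (a + m) := by
  simp [chainProd, List.range_succ]

theorem chainProd_succ' {Ω : Type*} [Fintype Ω] [DecidableEq Ω] (T : ℕ → Matrix Ω Ω ℝ) (a m : ℕ) :
    chainProd T a (m + 1) = T a * chainProd T (a + 1) m := by
  simp [chainProd, List.range_succ_eq_map, Function.comp_def, Nat.add_assoc, Nat.add_comm 1]

theorem chainProd_nonneg {Ω : Type*} [Fintype Ω] [DecidableEq Ω]
    {T : ℕ → Matrix Ω Ω ℝ} (hT : ∀ k, IsAveraging (T k)) (a m : ℕ) (ω ω' : Ω) :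
    0 ≤ chainProd T a m ω ω' := by
  induction m generalizing ω' with
  | zero =>
    rw [chainProd_zero, Matrix.one_apply]
    split_ifs <;> norm_num
  | succ m ih =>
    rw [chainProd_succ, Matrix.mul_apply]
    exact sum_nonneg fun α _ => mul_nonneg (ih α) ((hT _).nonneg _ _)

theorem sum_chainProd_row {Ω : Type*} [Fintype Ω] [DecidableEq Ω]
    {T : ℕ → Matrix Ω Ω ℝ} (hT : ∀ k, IsAveraging (T k)) (a m : ℕ) (ω : Ω) :
    ∑ ω', chainProd T a m ω ω' = 1 := by
  induction m with
  | zero => simp [chainProd_zero, Matrix.one_apply]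
  | succ m ih =>
    simp only [chainProd_succ, Matrix.mul_apply]
    rw [sum_comm]
    simp only [← mul_sum, (hT _).sum_row, mul_one, ih]

theorem chainWeight_snoc {Ω : Type*} (T : ℕ → Matrix Ω Ω ℝ) {n : ℕ} (c : Fin (n + 1) → Ω) (ω : Ω) :
    chainWeight T (Fin.snoc c ω : Fin (n + 2) → Ω)
      = chainWeight T c * T n (c (Fin.last n)) ω := by
  unfold chainWeight
  rw [Fin.prod_univ_castSucc]
  congr 1
  · refine prod_congr rfl fun k _ => ?_
    rw [Fin.snoc_castSucc, ← Fin.castSucc_succ, Fin.snoc_castSucc]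
    rfl
  · rw [Fin.snoc_castSucc, Fin.succ_last, Fin.snoc_last]
    rfl

theorem chainWeight_cons {Ω : Type*} (T : ℕ → Matrix Ω Ω ℝ) {n : ℕ} (c : Fin (n + 1) → Ω) (ω : Ω) :
    chainWeight T (Fin.cons ω c : Fin (n + 2) → Ω)
      = T 0 ω (c 0) * chainWeight (fun k => T (k + 1)) c := by
  unfold chainWeight
  rw [Fin.prod_univ_succ]
  congr 1

theorem sum_fin_snoc {Ω : Type*} [Fintype Ω] {n : ℕ} (F : (Fin (n + 2) → Ω) → ℝ) :
    ∑ c, F c = ∑ c : Fin (n + 1) → Ω, ∑ ω, F (Fin.snoc c ω) := by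
  rw [← (Fin.snocEquiv fun _ : Fin (n + 2) => Ω).sum_comp, Fintype.sum_prod_type, sum_comm]
  rfl

theorem sum_fin_cons {Ω : Type*} [Fintype Ω] {n : ℕ} (F : (Fin (n + 2) → Ω) → ℝ) :
    ∑ c, F c = ∑ c : Fin (n + 1) → Ω, ∑ ω, F (Fin.cons ω c) := by
  rw [← (Fin.consEquiv fun _ : Fin (n + 2) => Ω).sum_comp, Fintype.sum_prod_type, sum_comm]
  rfl

theorem sum_chainWeight_ends {Ω : Type*} [Fintype Ω] [DecidableEq Ω]
    (T : ℕ → Matrix Ω Ω ℝ) (n : ℕ) (g : Ω → Ω → ℝ) :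
    ∑ c : Fin (n + 1) → Ω, chainWeight T c * g (c 0) (c (Fin.last n))
      = ∑ α, ∑ β, chainProd T 0 n α β * g α β := by
  induction n generalizing g with
  | zero =>
    rw [← (Equiv.funUnique (Fin 1) Ω).symm.sum_comp]
    simp [chainWeight, chainProd_zero, Matrix.one_apply]
  | succ n ih =>
    rw [sum_fin_snoc]
    have : ∀ c : Fin (n + 1) → Ω,
        ∑ ω, chainWeight T (Fin.snoc c ω : Fin (n + 2) → Ω) *
          g ((Fin.snoc c ω : Fin (n + 2) → Ω) 0) ((Fin.snoc c ω : Fin (n + 2) → Ω) (Fin.last _))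
        = chainWeight T c * (fun α α' => ∑ ω, T n α' ω * g α ω) (c 0) (c (Fin.last n)) := by
      intro c
      simp only [chainWeight_snoc, Fin.snoc_last, mul_sum]
      refine sum_congr rfl fun ω _ => ?_
      rw [← Fin.castSucc_zero, Fin.snoc_castSucc]
      ring
    rw [sum_congr rfl fun c _ => this c]
    refine (ih fun α α' => ∑ ω, T n α' ω * g α ω).trans ?_
    refine sum_congr rfl fun α _ => ?_
    simp only [chainProd_succ, Matrix.mul_apply, mul_sum, sum_mul, zero_add]
    rw [sum_comm]
    refine sum_congr rfl fun β _ => sum_congr rfl fun ω _ => ?_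
    ring

/-- The joint law of the states at two times of the chain. -/
theorem sum_chainWeight_pair {Ω : Type*} [Fintype Ω] [DecidableEq Ω]
    {T : ℕ → Matrix Ω Ω ℝ} (hT : ∀ k, IsAveraging (T k)) (n a m : ℕ)
    (h : a + m ≤ n) (g : Ω → Ω → ℝ) :
    ∑ c : Fin (n + 1) → Ω, chainWeight T c * g (c ⟨a, by omega⟩) (c ⟨a + m, by omega⟩)
      = ∑ α, ∑ β, chainProd T a m α β * g α β := by
  induction n generalizing T a with
  | zero =>
    obtain rfl : a = 0 := by omega
    obtain rfl : m = 0 := by omega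
    exact sum_chainWeight_ends T 0 g
  | succ n ih =>
    rcases Nat.lt_or_ge (a + m) (n + 1) with h1 | h1
    · -- the last state is free, and the rows of `T n` sum to one
      rw [sum_fin_snoc, ← ih hT a (by omega)]
      refine sum_congr rfl fun c _ => ?_
      have e : ∀ (i : ℕ) (hi : i < n + 1) (ω : Ω),
          (Fin.snoc c ω : Fin (n + 2) → Ω) ⟨i, by omega⟩ = c ⟨i, hi⟩ := fun i hi ω =>
        Fin.snoc_castSucc (α := fun _ : Fin (n + 2) => Ω) ω c ⟨i, hi⟩
      simp only [chainWeight_snoc, e a (by omega), e (a + m) (by omega)]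
      rw [← sum_mul, ← mul_sum, (hT n).sum_row, mul_one]
    · rcases a with _ | a
      · obtain rfl : m = n + 1 := by omega
        simp only [zero_add]
        exact sum_chainWeight_ends T (n + 1) g
      · -- the first state is free, and the columns of `T 0` sum to one
        have h2 : chainProd T (a + 1) m = chainProd (fun k => T (k + 1)) a m := by
          simp [chainProd, Nat.add_right_comm]
        rw [sum_fin_cons, h2, ← ih (fun k => hT (k + 1)) a (by omega)]
        refine sum_congr rfl fun c _ => ?_
        have e : ∀ (i j : ℕ) (hi : i < n + 1) (hj : j < n + 2) (_ : j = i + 1) (ω : Ω),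
            (Fin.cons ω c : Fin (n + 2) → Ω) ⟨j, hj⟩ = c ⟨i, hi⟩ := by
          rintro i j hi hj rfl ω
          exact Fin.cons_succ (α := fun _ : Fin (n + 2) => Ω) ω c ⟨i, hi⟩
        simp only [chainWeight_cons, e a (a + 1) (by omega) (by omega) rfl,
          e (a + m) (a + 1 + m) (by omega) (by omega) (by omega)]
        rw [← sum_mul, ← sum_mul]
        simp only [(hT 0).symm _ (c 0), (hT 0).sum_row, one_mul]

/-- Seen from any two states in between, the states at two times are independent and uniform in
their classes. If this makes `g` small on average, then `g` is small on average over the chain. -/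
theorem sum_chainWeight_pair_le {Ω : Type*} [Fintype Ω] [DecidableEq Ω]
    {T : ℕ → Matrix Ω Ω ℝ} (hT : ∀ k, IsAveraging (T k))
    (n a b : ℕ) (hab : a < b) (hb : b ≤ n) (g : Ω → Ω → ℝ) (η : ℝ)
    (hg : ∀ α' β', ∑ α, ∑ β, T a α' α * T (b - 1) β' β * g α β ≤ η) :
    ∑ c : Fin (n + 1) → Ω, chainWeight T c * g (c ⟨a, by omega⟩) (c ⟨b, by omega⟩)
      ≤ η * Fintype.card Ω := by
  obtain ⟨m, rfl⟩ : ∃ m, b = a + (m + 1) := ⟨b - a - 1, by omega⟩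
  rw [sum_chainWeight_pair hT n a (m + 1) hb]
  -- a stochastic matrix in the middle
  obtain ⟨N, hN0, hN1, hN⟩ : ∃ N : Matrix Ω Ω ℝ, (∀ ω ω', 0 ≤ N ω ω') ∧ (∀ ω, ∑ ω', N ω ω' = 1) ∧
      chainProd T a (m + 1) = T a * N * T (a + m) := by
    rcases m with _ | m
    · refine ⟨1, fun ω ω' => ?_, fun ω => ?_, ?_⟩
      · rw [Matrix.one_apply]
        split_ifs <;> norm_num
      · simp [Matrix.one_apply]
      · rw [chainProd_succ, chainProd_zero, mul_one, one_mul, add_zero, (hT a).idem]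
    · refine ⟨chainProd T (a + 1) m, chainProd_nonneg hT _ _, sum_chainProd_row hT _ _, ?_⟩
      rw [chainProd_succ', chainProd_succ, mul_assoc]
      congr 3
      omega
  rw [hN]
  have h1 : ∑ α, ∑ β, (T a * N * T (a + m)) α β * g α β
      = ∑ α', ∑ β', N α' β' * ∑ α, ∑ β, T a α' α * T (a + m) β' β * g α β := by
    simp only [Matrix.mul_apply, sum_mul, mul_sum]
    calc ∑ α, ∑ β, ∑ β', ∑ α', T a α α' * N α' β' * T (a + m) β' β * g α β
        = ∑ α, ∑ α', ∑ β', ∑ β, T a α α' * N α' β' * T (a + m) β' β * g α β := by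
          refine sum_congr rfl fun α _ => ?_
          rw [sum_comm, sum_congr rfl fun β' _ => sum_comm, sum_comm]
      _ = _ := by
          rw [sum_comm]
          refine sum_congr rfl fun α' _ => ?_
          rw [sum_comm]
          refine sum_congr rfl fun β' _ => sum_congr rfl fun α _ => sum_congr rfl fun β _ => ?_
          rw [(hT a).symm α α']
          ring
  rw [h1]
  simp only [show a + (m + 1) - 1 = a + m by omega] at hg
  calc _ ≤ ∑ α', ∑ β', N α' β' * η := by
        refine sum_le_sum fun α' _ => sum_le_sum fun β' _ => ?_
        exact mul_le_mul_of_nonneg_left (hg α' β') (hN0 _ _)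
    _ = η * Fintype.card Ω := by
        simp only [← sum_mul, hN1]
        simp [mul_comm]

theorem chainWeight_nonneg {Ω : Type*} [Fintype Ω]
    {T : ℕ → Matrix Ω Ω ℝ} (hT : ∀ k, IsAveraging (T k)) {n : ℕ}
    (c : Fin (n + 1) → Ω) : 0 ≤ chainWeight T c :=
  prod_nonneg fun k _ => (hT k).nonneg _ _

theorem sum_chainWeight {Ω : Type*} [Fintype Ω] [DecidableEq Ω]
    {T : ℕ → Matrix Ω Ω ℝ} (hT : ∀ k, IsAveraging (T k)) (n : ℕ) :
    ∑ c : Fin (n + 1) → Ω, chainWeight T c = Fintype.card Ω := by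
  have := sum_chainWeight_ends T n (fun _ _ => 1)
  simp only [mul_one, sum_chainProd_row hT] at this
  rw [this]
  simp

/-- Union bound: some trajectory of positive weight avoids all of fewer than `1 / η` events, each
of which has probability at most `η`. -/
theorem exists_chain_avoiding {Ω : Type*} [Fintype Ω] [DecidableEq Ω]
    {T : ℕ → Matrix Ω Ω ℝ} (hT : ∀ k, IsAveraging (T k)) [Nonempty Ω]
    (n : ℕ) {I : Type*} (S : Finset I) (E : I → (Fin (n + 1) → Ω) → Prop)
    [∀ i c, Decidable (E i c)] (η : ℝ)
    (hE : ∀ i ∈ S, ∑ c, chainWeight T c * (if E i c then 1 else 0) ≤ η * Fintype.card Ω)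
    (hS : #S * η < 1) :
    ∃ c : Fin (n + 1) → Ω, (∀ k : Fin n, T k (c k.castSucc) (c k.succ) ≠ 0) ∧
      ∀ i ∈ S, ¬ E i c := by
  by_contra! hcon
  have hΩ : (0 : ℝ) < Fintype.card Ω := by exact_mod_cast Fintype.card_pos
  have h1 : ∑ c : Fin (n + 1) → Ω, chainWeight T c
      ≤ ∑ c, ∑ i ∈ S, chainWeight T c * (if E i c then 1 else 0) := by
    refine sum_le_sum fun c _ => ?_
    have hpos : ∀ i ∈ S, 0 ≤ chainWeight T c * (if E i c then (1 : ℝ) else 0) := fun i _ =>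
      mul_nonneg (chainWeight_nonneg hT c) (by split_ifs <;> norm_num)
    by_cases hc : ∀ k : Fin n, T k (c k.castSucc) (c k.succ) ≠ 0
    · obtain ⟨i, hi, hEi⟩ := hcon c hc
      refine le_trans ?_ (single_le_sum hpos hi)
      simp [hEi]
    · push Not at hc
      obtain ⟨k, hk⟩ := hc
      rw [chainWeight, prod_eq_zero (mem_univ k) hk]
      exact sum_nonneg fun i _ => by simp
  rw [sum_chainWeight hT, sum_comm] at h1
  have h2 := h1.trans (sum_le_sum hE)
  simp only [sum_const, nsmul_eq_mul] at h2
  nlinarith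

/-! ### Induced cycles from spread families of states -/

theorem InConflict.symm {V : Type*} {G : SimpleGraph V} {v w : V} (h : InConflict G v w) :
    InConflict G w v :=
  h.elim (fun h => Or.inl h.symm) fun h => Or.inr h.symm

/-- An induced cycle given by a sequence of vertices, of which only the first `N` matter. -/
theorem cycleGraph_isIndContained {V : Type*} {G : SimpleGraph V} {N : ℕ} (φ : ℕ → V) (hN : 3 ≤ N)
    (hadj : ∀ n, n + 1 < N → G.Adj (φ n) (φ (n + 1))) (hclose : G.Adj (φ (N - 1)) (φ 0))
    (hfar : ∀ n n', n + 2 ≤ n' → n' < N → (n ≠ 0 ∨ n' ≠ N - 1) → ¬ InConflict G (φ n) (φ n')) :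
    (SimpleGraph.cycleGraph N).IsIndContained G := by
  have hcyc : ∀ a b : Fin N, a.val < b.val → ((SimpleGraph.cycleGraph N).Adj a b ↔
      (b.val = a.val + 1 ∨ (a.val = 0 ∧ b.val = N - 1))) := by
    intro a b hab
    rw [SimpleGraph.cycleGraph_adj', Fin.coe_sub_iff_lt.mpr hab, Fin.sub_val_of_le hab.le]
    have := b.isLt
    omega
  have key : ∀ a b : Fin N, a.val < b.val → φ a ≠ φ b ∧
      (G.Adj (φ a) (φ b) ↔ (SimpleGraph.cycleGraph N).Adj a b) := by
    intro a b hab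
    rw [hcyc a b hab]
    by_cases h : b.val = a.val + 1 ∨ (a.val = 0 ∧ b.val = N - 1)
    · have h' : G.Adj (φ a) (φ b) := by
        rcases h with h | ⟨h1, h2⟩
        · rw [h]
          exact hadj _ (by have := b.isLt; omega)
        · rw [h1, h2]
          exact hclose.symm
      exact ⟨h'.ne, iff_of_true h' h⟩
    · have h' := hfar a b (by omega) b.isLt (by omega)
      exact ⟨fun e => h' (Or.inl e), iff_of_false (fun e => h' (Or.inr e)) h⟩
  refine ⟨⟨⟨fun a => φ a, fun a b hab => ?_⟩, fun {a b} => ?_⟩⟩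
  · rcases lt_trichotomy a.val b.val with h | h | h
    · exact absurd hab (key a b h).1
    · exact Fin.ext h
    · exact absurd hab.symm (key b a h).1
  · change G.Adj (φ a) (φ b) ↔ _
    rcases lt_trichotomy a.val b.val with h | h | h
    · exact (key a b h).2
    · rw [Fin.ext h]
      simp
    · rw [G.adj_comm, (key b a h).2, SimpleGraph.adj_comm]

open Classical in
/-- Within every class of `key`, the value of `x` at a uniformly random state is any given vertex
with probability at most `1 / M`. -/
def IsSpread {Ω A V : Type*} [Fintype Ω] (key : Ω → A) (x : Ω → V) (M : ℝ) : Prop :=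
  ∀ ω z, M * (#{α | key α = key ω ∧ x α = z} : ℝ) ≤ #{α | key α = key ω}

open Classical in
/-- A form of `IsSpread` that refers to the transition matrix only. -/
def IsSpreadUnder {Ω V : Type*} [Fintype Ω] (T : Matrix Ω Ω ℝ) (x : Ω → V) (M : ℝ) : Prop :=
  ∀ ω, ∃ C : Finset Ω, C.Nonempty ∧ (∀ ω', T ω ω' = if ω' ∈ C then (#C : ℝ)⁻¹ else 0) ∧
    ∀ z, M * (#{α ∈ C | x α = z} : ℝ) ≤ #C

open Classical in
theorem IsSpread.isSpreadUnder {Ω A V : Type*} [Fintype Ω] {key : Ω → A} {x : Ω → V} {M : ℝ}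
    (h : IsSpread key x M) : IsSpreadUnder (resample key) x M := by
  intro ω
  refine ⟨univ.filter fun α => key α = key ω, ⟨ω, by simp⟩, fun ω' => ?_, fun z => ?_⟩
  · simp [resample]
  · rw [filter_filter]
    exact h ω z

open Classical in
/-- Independent states drawn from any two rows of spread transition matrices are rarely in
conflict. -/
theorem sum_inConflict_le {V Ω : Type*} [Fintype V] [Fintype Ω] (G : SimpleGraph V)
    [DecidableRel G.Adj] {ε τ M : ℝ} (hG : IsLocallySparse G (1 - ε) τ) (hε : 0 ≤ ε) (hτ : 0 < τ)
    (hM : 0 < M) {T₁ T₂ : Matrix Ω Ω ℝ} {x y : Ω → V} (hx : IsSpreadUnder T₁ x M)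
    (hy : IsSpreadUnder T₂ y M) (α' β' : Ω) :
    ∑ α, ∑ β, T₁ α' α * T₂ β' β * (if InConflict G (x α) (y β) then 1 else 0)
      ≤ ε + 2 * τ / M + 1 / M := by
  obtain ⟨C₁, hne₁, hT₁, hC₁⟩ := hx α'
  obtain ⟨C₂, hne₂, hT₂, hC₂⟩ := hy β'
  have h := card_pairs_inConflict_le G hG hε hτ hM C₁ C₂ x y hC₁ hC₂
  have h1 : (0 : ℝ) < #C₁ := by exact_mod_cast hne₁.card_pos
  have h2 : (0 : ℝ) < #C₂ := by exact_mod_cast hne₂.card_pos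
  have e : ∑ α, ∑ β, T₁ α' α * T₂ β' β * (if InConflict G (x α) (y β) then (1 : ℝ) else 0)
      = (∑ β ∈ C₂, (#{α ∈ C₁ | InConflict G (x α) (y β)} : ℝ)) / (#C₁ * #C₂) := by
    rw [sum_comm, sum_div]
    simp only [hT₁, hT₂]
    rw [← sum_subset (subset_univ C₂) (by intro β _ hβ; simp [hβ])]
    refine sum_congr rfl fun β hβ => ?_
    rw [← sum_subset (subset_univ C₁) (by intro α _ hα; simp [hα]), card_filter]
    push_cast
    rw [sum_div]
    refine sum_congr rfl fun α hα => ?_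
    rw [if_pos hα, if_pos hβ]
    split_ifs
    · field_simp
    · simp
  rw [e, div_le_iff₀ (by positivity)]
  linarith

open Classical in
/-- The induced cycle is read off a random trajectory that alternately resamples the whole state
given the endpoint `R ω r`, and resamples the state given `κ ω`. It consists of the base vertex,
the path of the first state, the vertices that are kept in the successive steps, and the path of
the last state. A vertex kept in step `k` is determined by the state at time `k` and by the state
at time `k + 1`; for two vertices of the cycle, the later time of the earlier vertex precedes the
earlier time of the later vertex, so that the two are nearly independent. The exceptions are the
pairs within the first or the last path and the pairs with the base vertex, and these are not in
conflict by assumption. Paths are sequences of which only the terms up to `r` matter. -/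
theorem cycleGraph_isIndContained_of_isSpread {V Ω Q : Type*} [Fintype V] [Fintype Ω] [Nonempty Ω]
    (G : SimpleGraph V) [DecidableRel G.Adj] {ε τ M : ℝ} (hG : IsLocallySparse G (1 - ε) τ)
    (hε : 0 ≤ ε) (hτ : 0 < τ) (hM : 0 < M) (r j : ℕ) (hr : 2 ≤ r) (b : V) (R : Ω → ℕ → V)
    (hR0 : ∀ ω, R ω 0 = b) (hRadj : ∀ ω, ∀ i < r, G.Adj (R ω i) (R ω (i + 1)))
    (hRfar : ∀ ω i i', i + 2 ≤ i' → i' ≤ r → ¬ InConflict G (R ω i) (R ω i'))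
    (q : Ω → V) (hq : ∀ ω, G.Adj (R ω r) (q ω)) (hbq : ∀ ω, ¬ InConflict G b (q ω))
    (κ : Ω → Q) (hκ : ∀ ω ω', κ ω = κ ω' → q ω = q ω')
    (hspread : ∀ i, 0 < i → i < r → IsSpread (fun ω => R ω r) (fun ω => R ω i) M)
    (hspread_q : IsSpread (fun ω => R ω r) q M)
    (hspread_end : IsSpread κ (fun ω => R ω r) M)
    (hsmall : (2 * (r : ℝ) + 2 * j) ^ 2 * (ε + 2 * τ / M + 1 / M) < 1) :
    (SimpleGraph.cycleGraph (2 * r + 2 * j)).IsIndContained G := by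
  set η := ε + 2 * τ / M + 1 / M with hη
  have hη0 : 0 ≤ η := by positivity
  let T : ℕ → Matrix Ω Ω ℝ := fun k =>
    if Even k then resample (fun ω => R ω r) else resample κ
  have hT : ∀ k, IsAveraging (T k) := by
    intro k
    by_cases h : Even k
    · simpa only [T, if_pos h] using isAveraging_resample _
    · simpa only [T, if_neg h] using isAveraging_resample _
  -- `y k` is the vertex that is kept in step `k`
  let y : ℕ → Ω → V := fun k => if Even k then (fun ω => R ω r) else q
  have hyT : ∀ k ω ω', T k ω ω' ≠ 0 → y k ω = y k ω' := by
    intro k ω ω' h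
    by_cases hk : Even k
    · simp only [T, if_pos hk, resample] at h
      simp only [y, if_pos hk]
      by_contra hne
      exact h (if_neg (Ne.symm hne))
    · simp only [T, if_neg hk, resample] at h
      simp only [y, if_neg hk]
      refine hκ _ _ ?_
      by_contra hne
      exact h (if_neg (Ne.symm hne))
  have hyadj : ∀ k ω, G.Adj (y k ω) (y (k + 1) ω) := by
    intro k ω
    by_cases hk : Even k
    · have hk' : ¬ Even (k + 1) := by simpa [Nat.even_add_one] using hk
      simp only [y, if_pos hk, if_neg hk']
      exact hq ω
    · have hk' : Even (k + 1) := by simpa [Nat.even_add_one] using hk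
      simp only [y, if_neg hk, if_pos hk']
      exact (hq ω).symm
  have hby : ∀ k ω, ¬ InConflict G b (y k ω) := by
    intro k ω
    by_cases hk : Even k
    · simp only [y, if_pos hk]
      rw [← hR0 ω]
      exact hRfar ω 0 r (by omega) le_rfl
    · simp only [y, if_neg hk]
      exact hbq ω
  have hyeven : ∀ i ω, y (2 * i) ω = R ω r := by
    intro i ω
    simp [y]
  have hspreadR : ∀ k, Even k → ∀ i, 0 < i → i < r → IsSpreadUnder (T k) (fun ω => R ω i) M := by
    intro k hk i hi hi'
    simp only [T, if_pos hk]
    exact (hspread i hi hi').isSpreadUnder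
  have hspread_succ : ∀ k, IsSpreadUnder (T (k + 1)) (y k) M := by
    intro k
    by_cases hk : Even k
    · have hk' : ¬ Even (k + 1) := by simpa [Nat.even_add_one] using hk
      simp only [T, y, if_neg hk', if_pos hk]
      exact hspread_end.isSpreadUnder
    · have hk' : Even (k + 1) := by simpa [Nat.even_add_one] using hk
      simp only [T, y, if_pos hk', if_neg hk]
      exact hspread_q.isSpreadUnder
  have hspread_pred : ∀ k, IsSpreadUnder (T k) (y (k + 1)) M := by
    intro k
    by_cases hk : Even k
    · have hk' : ¬ Even (k + 1) := by simpa [Nat.even_add_one] using hk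
      simp only [T, y, if_neg hk', if_pos hk]
      exact hspread_q.isSpreadUnder
    · have hk' : Even (k + 1) := by simpa [Nat.even_add_one] using hk
      simp only [T, y, if_pos hk', if_neg hk]
      exact hspread_end.isSpreadUnder
  set N := 2 * r + 2 * j with hNdef
  -- the vertex at position `n` of the cycle, as a function of the state at time `n - r`, or of
  -- the state at time `n + 1 - r`
  let x : ℕ → Ω → V := fun n ω =>
    if n < r then R ω n else if n ≤ r + 2 * j then y (n - r) ω else R ω (N - n)
  -- the pairs of positions that are left to chance
  let S : Finset (ℕ × ℕ) := {m ∈ range N ×ˢ range N |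
    0 < m.1 ∧ m.1 + 2 ≤ m.2 ∧ m.1 < r + 2 * j ∧ r < m.2 ∧ m.2 < N}
  have hS : (#S : ℝ) * η < 1 := by
    have h1 : #S ≤ N ^ 2 := by
      refine (card_filter_le _ _).trans ?_
      rw [card_product, card_range, sq]
    have h2 : (#S : ℝ) ≤ (2 * (r : ℝ) + 2 * j) ^ 2 := by
      have : (#S : ℝ) ≤ (N : ℝ) ^ 2 := by exact_mod_cast h1
      simpa [hNdef] using this
    exact lt_of_le_of_lt (mul_le_mul_of_nonneg_right h2 hη0) hsmall
  let E : ℕ × ℕ → (Fin (2 * j + 1 + 1) → Ω) → Prop := fun m c =>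
    InConflict G (x m.1 (c ⟨min (m.1 + 1 - r) (2 * j + 1), by omega⟩))
      (x m.2 (c ⟨min (m.2 - r) (2 * j + 1), by omega⟩))
  have hE : ∀ m ∈ S, ∑ c, chainWeight T c * (if E m c then 1 else 0) ≤ η * Fintype.card Ω := by
    rintro ⟨n, n'⟩ hm
    simp only [S, mem_filter, mem_product, mem_range] at hm
    obtain ⟨-, hn0, hnn', hn, hn', hN'⟩ := hm
    refine sum_chainWeight_pair_le hT (2 * j + 1) (min (n + 1 - r) (2 * j + 1))
      (min (n' - r) (2 * j + 1)) (by omega) (by omega)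
      (fun α β => if InConflict G (x n α) (x n' β) then 1 else 0) η ?_
    refine sum_inConflict_le G hG hε hτ hM ?_ ?_
    · rcases Nat.lt_or_ge n r with h | h
      · have e : x n = fun ω => R ω n := by
          funext ω
          simp [x, h]
        rw [e, show min (n + 1 - r) (2 * j + 1) = 0 by omega]
        exact hspreadR 0 (by simp) n hn0 h
      · have e : x n = y (n - r) := by
          funext ω
          simp [x, not_lt.2 h, hn.le]
        rw [e, show min (n + 1 - r) (2 * j + 1) = (n - r) + 1 by omega]
        exact hspread_succ _
    · rcases Nat.lt_or_ge (r + 2 * j) n' with h | h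
      · have e : x n' = fun ω => R ω (N - n') := by
          funext ω
          simp [x, show ¬ n' < r by omega, not_le.2 h]
        rw [e, show min (n' - r) (2 * j + 1) - 1 = 2 * j by omega]
        exact hspreadR _ (by simp) _ (by omega) (by omega)
      · have e : x n' = y (n' - r - 1 + 1) := by
          funext ω
          simp [x, show ¬ n' < r by omega, h, show n' - r - 1 + 1 = n' - r by omega]
        rw [e, show min (n' - r) (2 * j + 1) - 1 = n' - r - 1 by omega]
        exact hspread_pred _
  obtain ⟨c, hc, hcS⟩ := exists_chain_avoiding hT (2 * j + 1) S E η hE hS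
  let cc : ℕ → Ω := fun k => c ⟨min k (2 * j + 1), by omega⟩
  have hkeep : ∀ k ≤ 2 * j, y k (cc k) = y k (cc (k + 1)) := by
    intro k hk
    have h := hyT k _ _ (hc ⟨k, by omega⟩)
    have e1 : cc k = c (Fin.castSucc ⟨k, by omega⟩) := by
      simp only [cc]
      congr 1
      ext
      simp
      omega
    have e2 : cc (k + 1) = c (Fin.succ ⟨k, by omega⟩) := by
      simp only [cc]
      congr 1
      ext
      simp
      omega
    rw [e1, e2]
    exact h
  have hcc : ∀ k, 2 * j + 1 ≤ k → cc k = cc (2 * j + 1) := by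
    intro k hk
    simp only [cc]
    congr 2
    omega
  let φ : ℕ → V := fun n => x n (cc (n - r))
  have hφ : ∀ n, φ n = x n (cc (n + 1 - r)) := by
    intro n
    simp only [φ]
    rcases Nat.lt_or_ge n r with h | h
    · rw [show n - r = n + 1 - r by omega]
    · rcases Nat.lt_or_ge (r + 2 * j) n with h' | h'
      · rw [hcc (n - r) (by omega), hcc (n + 1 - r) (by omega)]
      · have e : x n = y (n - r) := by
          funext ω
          simp [x, not_lt.2 h, h']
        rw [e, show n + 1 - r = n - r + 1 by omega]
        exact hkeep _ (by omega)
  have hφ_first : ∀ n ≤ r, φ n = R (cc 0) n := by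
    intro n hn
    simp only [φ, x, show n - r = 0 by omega]
    rcases hn.lt_or_eq with h | rfl
    · simp [h]
    · simpa using hyeven 0 (cc 0)
  have hφ_mid : ∀ e ≤ 2 * j, φ (r + e) = y e (cc e) := by
    intro e he
    simp [φ, x, he]
  have hφ_last : ∀ n, r + 2 * j ≤ n → φ n = R (cc (2 * j + 1)) (N - n) := by
    intro n hn
    rcases hn.lt_or_eq with h | rfl
    · simp [φ, x, show ¬ n < r by omega, not_le.2 h, hcc (n - r) (by omega)]
    · rw [hφ_mid _ le_rfl, hkeep _ le_rfl, hyeven]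
      congr 1
      omega
  refine cycleGraph_isIndContained φ (by omega) ?_ ?_ ?_
  · intro n hn
    rcases Nat.lt_or_ge n r with h | h
    · rw [hφ_first n h.le, hφ_first (n + 1) (by omega)]
      exact hRadj _ n h
    · rcases Nat.lt_or_ge n (r + 2 * j) with h' | h'
      · obtain ⟨e, rfl⟩ := Nat.exists_eq_add_of_le h
        rw [hφ_mid e (by omega), show r + e + 1 = r + (e + 1) by omega, hφ_mid (e + 1) (by omega),
          hkeep e (by omega)]
        exact hyadj e _
      · rw [hφ_last n h', hφ_last (n + 1) (by omega)]
        have := hRadj (cc (2 * j + 1)) (N - (n + 1)) (by omega)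
        rw [show N - (n + 1) + 1 = N - n by omega] at this
        exact this.symm
  · rw [hφ_last (N - 1) (by omega), hφ_first 0 (by omega), hR0, ← hR0 (cc (2 * j + 1)),
      show N - (N - 1) = 0 + 1 by omega]
    exact (hRadj _ 0 (by omega)).symm
  · intro n n' hnn' hn' hne
    by_cases h0 : n = 0
    · subst h0
      rw [hφ_first 0 (by omega), hR0]
      rcases Nat.lt_or_ge n' r with h | h
      · rw [hφ_first n' h.le, ← hR0 (cc 0)]
        exact hRfar _ 0 n' hnn' h.le
      · rcases Nat.lt_or_ge (r + 2 * j) n' with h' | h'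
        · rw [hφ_last n' h'.le, ← hR0 (cc (2 * j + 1))]
          exact hRfar _ 0 _ (by omega) (by omega)
        · obtain ⟨e, rfl⟩ := Nat.exists_eq_add_of_le h
          rw [hφ_mid e (by omega)]
          exact hby _ _
    · by_cases h1 : n' ≤ r
      · rw [hφ_first n (by omega), hφ_first n' h1]
        exact hRfar _ n n' hnn' h1
      · by_cases h2 : r + 2 * j ≤ n
        · rw [hφ_last n h2, hφ_last n' (by omega)]
          exact fun hcon => hRfar _ (N - n') (N - n) (by omega) (by omega) hcon.symm
        · rw [hφ n]
          exact hcS (n, n') (by simp [S]; omega)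

/-! ### Deleting small fibres, and bad paths of length at least three -/

open Classical in
/-- If `Q` maximizes its size minus the thresholds of its fibres, then deleting a fibre of `p` does
not pay, so this fibre is above its threshold. -/
theorem le_card_fiber_of_isMax {Ω A B : Type*}
    (p : Ω → A) (κ : Ω → B) (a : A → ℝ) (b : B → ℝ) (hb : ∀ x, 0 ≤ b x) (Q : Finset Ω)
    (hQ : ∀ Q' ⊆ Q, (#Q' : ℝ) - ∑ x ∈ Q'.image p, a x - ∑ x ∈ Q'.image κ, b x
      ≤ #Q - ∑ x ∈ Q.image p, a x - ∑ x ∈ Q.image κ, b x) (ω : Ω) (hω : ω ∈ Q) :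
    a (p ω) ≤ #{α ∈ Q | p α = p ω} := by
  have h := hQ {α ∈ Q | ¬ p α = p ω} (filter_subset _ _)
  have h1 := card_filter_add_card_filter_not (s := Q) (fun α => p α = p ω)
  have h1' : (#{α ∈ Q | p α = p ω} : ℝ) + #{α ∈ Q | ¬ p α = p ω} = #Q := by exact_mod_cast h1
  have h2 : ({α ∈ Q | ¬ p α = p ω} : Finset Ω).image p = (Q.image p).erase (p ω) := by
    ext x
    simp only [mem_image, mem_filter, mem_erase]
    constructor
    · rintro ⟨α, ⟨h, h'⟩, rfl⟩
      exact ⟨h', α, h, rfl⟩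
    · rintro ⟨h', α, h, rfl⟩
      exact ⟨α, ⟨h, h'⟩, rfl⟩
  have h3 : ∑ x ∈ ({α ∈ Q | ¬ p α = p ω} : Finset Ω).image κ, b x ≤ ∑ x ∈ Q.image κ, b x :=
    sum_le_sum_of_subset_of_nonneg (image_subset_image (filter_subset _ _)) fun x _ _ => hb x
  have h4 := add_sum_erase (Q.image p) a (mem_image_of_mem p hω)
  rw [h2] at h
  linarith

open Classical in
/-- If few elements are lost by deleting the fibres of `p` and `κ` that are below a threshold, then
iterating this deletion leaves a nonempty set all of whose fibres are above the thresholds. The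
surviving set is found as the maximizer of its size minus the thresholds of its fibres. -/
theorem exists_subset_card_fiber_ge {Ω A B : Type*}
    (S : Finset Ω) (p : Ω → A) (κ : Ω → B) (a : A → ℝ) (b : B → ℝ) (ha : ∀ x, 0 ≤ a x)
    (hb : ∀ x, 0 ≤ b x) (hS : ∑ x ∈ S.image p, a x + ∑ x ∈ S.image κ, b x < #S) :
    ∃ Q ⊆ S, Q.Nonempty ∧ (∀ ω ∈ Q, a (p ω) ≤ #{α ∈ Q | p α = p ω}) ∧
      ∀ ω ∈ Q, b (κ ω) ≤ #{α ∈ Q | κ α = κ ω} := by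
  let f : Finset Ω → ℝ := fun Q => (#Q : ℝ) - ∑ x ∈ Q.image p, a x - ∑ x ∈ Q.image κ, b x
  obtain ⟨Q, hQ, hmax⟩ := S.powerset.exists_max_image f ⟨S, mem_powerset_self S⟩
  have hQS := mem_powerset.1 hQ
  have hf : ∀ Q' ⊆ Q, f Q' ≤ f Q := fun Q' h => hmax Q' (mem_powerset.2 (h.trans hQS))
  refine ⟨Q, hQS, ?_, le_card_fiber_of_isMax p κ a b hb Q hf,
    le_card_fiber_of_isMax κ p b a ha Q fun Q' h => ?_⟩
  · by_contra hne
    have h := hmax S (mem_powerset_self S)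
    rw [not_nonempty_iff_eq_empty.1 hne] at h
    simp only [f, card_empty, image_empty, sum_empty] at h
    norm_num at h
    linarith
  · have := hf Q' h
    simp only [f] at this
    linarith

open Classical in
/-- Spreadness on a subtype, in terms of the finset. -/
theorem isSpread_coe {Ω A V : Type*} {Q : Finset Ω} {key : Ω → A} {x : Ω → V} {M : ℝ}
    (h : ∀ ω ∈ Q, ∀ z, M * (#{α ∈ Q | key α = key ω ∧ x α = z} : ℝ) ≤ #{α ∈ Q | key α = key ω}) :
    IsSpread (fun ω : Q => key ω) (fun ω : Q => x ω) M := by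
  have hcard : ∀ (P : Ω → Prop) [DecidablePred P], #{α : Q | P α} = #{α ∈ Q | P α} := by
    intro P _
    rw [← card_map (Function.Embedding.subtype _)]
    congr 1
    ext α
    simp [and_comm]
  intro ω z
  have := h ω ω.2 z
  rw [← hcard fun α => key α = key ω ∧ x α = z, ← hcard fun α => key α = key ω] at this
  exact this

open Classical in
/-- There are at most `Δ ^ m` walks of length `m` from a given vertex. -/
theorem card_walks_le {V : Type*} [Fintype V] (G : SimpleGraph V) [DecidableRel G.Adj] (u : V)
    (m : ℕ) : #{c : Fin (m + 1) → V | c 0 = u ∧ ∀ k : Fin m, G.Adj (c k.castSucc) (c k.succ)}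
      ≤ G.maxDegree ^ m := by
  induction m with
  | zero =>
    rw [pow_zero, card_le_one]
    intro c hc c' hc'
    simp only [mem_filter, mem_univ, true_and] at hc hc'
    funext i
    obtain rfl : i = 0 := Fin.fin_one_eq_zero i
    exact hc.1.trans hc'.1.symm
  | succ m ih =>
    refine (card_le_mul_card_image (f := fun c : Fin (m + 2) → V => (Fin.init c : Fin (m + 1) → V))
      _ G.maxDegree ?_).trans ?_
    · intro c' _
      refine le_trans ?_ (G.degree_le_maxDegree (c' (Fin.last m)))
      rw [← G.card_neighborFinset_eq_degree]
      refine card_le_card_of_injOn (fun c => c (Fin.last (m + 1))) ?_ ?_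
      · intro c hc
        simp only [coe_filter, mem_filter, mem_univ, true_and, Set.mem_ofPred_eq] at hc
        obtain ⟨⟨-, h⟩, rfl⟩ := hc
        rw [mem_coe, SimpleGraph.mem_neighborFinset]
        exact h (Fin.last m)
      · intro c hc c₂ hc₂ hcc
        simp only [coe_filter, mem_filter, mem_univ, true_and, Set.mem_ofPred_eq] at hc hc₂
        rw [← Fin.snoc_init_self c, ← Fin.snoc_init_self c₂, hc.2, hc₂.2]
        simp only at hcc
        rw [hcc]
    · rw [pow_succ, mul_comm]
      refine Nat.mul_le_mul_right _ (le_trans (card_le_card ?_) ih)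
      intro c' hc'
      simp only [mem_image, mem_filter, mem_univ, true_and] at hc' ⊢
      obtain ⟨c, ⟨h0, h⟩, rfl⟩ := hc'
      refine ⟨h0, fun k => ?_⟩
      have := h k.castSucc
      rw [← Fin.castSucc_succ] at this
      exact this

/-- The subpath of length `i` that starts at the vertex with index `a`. -/
def subpath {V : Type*} {s : ℕ} (p : Fin (s + 1) → V) (a i : ℕ) (h : a + i ≤ s) : Fin (i + 1) → V :=
  fun k => p ⟨a + k, by omega⟩

/-- All proper subpaths of an admissible path are good. -/
theorem IsAdmissible.isGood_subpath {V : Type*} {G : SimpleGraph V} {L t : ℝ} {s : ℕ}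
    {p : Fin (s + 1) → V} (hp : IsAdmissible G L t s p) (a i : ℕ) (hi : 1 ≤ i) (his : i < s)
    (h : a + i ≤ s) : IsGood G L t i (subpath p a i h) := by
  induction s generalizing a with
  | zero => omega
  | succ s ih =>
    rcases s with _ | s
    · omega
    · obtain ⟨-, h1, h2⟩ := hp
      rcases Nat.lt_or_ge i (s + 1) with h' | h'
      · rcases Nat.lt_or_ge (s + 1) (a + i) with h3 | h3
        · have := ih h2.1 (a - 1) h' (by omega)
          convert this using 1
          funext k
          simp only [subpath]
          congr 1
          ext
          simp
          omega
        · exact ih h1.1 a h' h3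
      · obtain rfl : i = s + 1 := by omega
        obtain rfl | rfl : a = 0 ∨ a = 1 := by omega
        · have e : subpath p 0 (s + 1) h = fun i => p i.castSucc := by
            funext k
            simp only [subpath]
            congr 1
            ext
            simp
          rw [e]
          exact h1
        · have e : subpath p 1 (s + 1) h = fun i => p i.succ := by
            funext k
            simp only [subpath]
            congr 1
            ext
            simp
            omega
          rw [e]
          exact h2

theorem IsGood.ncard_le {V : Type*} [Finite V] {G : SimpleGraph V} {L t : ℝ} {s : ℕ}
    {p : Fin (s + 1) → V} (hp : IsGood G L t s p) :
    (({q : Fin (s + 1) → V | IsAdmissible G L t s q ∧ q 0 = p 0 ∧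
      q (Fin.last s) = p (Fin.last s)}.ncard : ℕ) : ℝ) ≤ (L * t) ^ (s - 1) := by
  rcases hp.2 with rfl | h
  · simp only [Nat.sub_self, pow_zero, Nat.cast_le_one]
    rw [Set.ncard_le_one (Set.toFinite _)]
    rintro q ⟨-, h0, h1⟩ q' ⟨-, h0', h1'⟩
    funext k
    fin_cases k
    · exact h0.trans h0'.symm
    · exact h1.trans h1'.symm
  · exact h

/-- An interior vertex splits an admissible path into two good paths, so only few of the admissible
paths between two given endpoints have a given vertex at a given position. -/
theorem ncard_admissible_through_le {V : Type*} [Finite V] {G : SimpleGraph V} {L t : ℝ}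
    (hLt : 0 ≤ L * t) {s i : ℕ} (hi : 0 < i) (his : i < s) (u v x : V) :
    (({p : Fin (s + 1) → V | IsAdmissible G L t s p ∧ p 0 = u ∧ p (Fin.last s) = v ∧
      p ⟨i, by omega⟩ = x}.ncard : ℕ) : ℝ) ≤ (L * t) ^ (s - 2) := by
  set F := {p : Fin (s + 1) → V | IsAdmissible G L t s p ∧ p 0 = u ∧ p (Fin.last s) = v ∧
      p ⟨i, by omega⟩ = x} with hF
  rcases F.eq_empty_or_nonempty with h | ⟨p₀, hp₀⟩
  · rw [h]
    simp only [Set.ncard_empty, Nat.cast_zero]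
    positivity
  · let A := {q : Fin (i + 1) → V | IsAdmissible G L t i q ∧ q 0 = u ∧ q (Fin.last i) = x}
    let B := {q : Fin (s - i + 1) → V | IsAdmissible G L t (s - i) q ∧ q 0 = x ∧
      q (Fin.last (s - i)) = v}
    have hlast : ∀ p : Fin (s + 1) → V,
        subpath p i (s - i) (by omega) (Fin.last (s - i)) = p (Fin.last s) := by
      intro p
      simp only [subpath]
      congr 1
      ext
      simp
      omega
    have hmid : ∀ p : Fin (s + 1) → V,
        subpath p 0 i (by omega) (Fin.last i) = p ⟨i, by omega⟩ := by
      intro p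
      simp [subpath]
    have hA : (A.ncard : ℝ) ≤ (L * t) ^ (i - 1) := by
      have h := (hp₀.1.isGood_subpath 0 i hi his (by omega)).ncard_le
      rw [hmid, hp₀.2.2.2, show subpath p₀ 0 i (by omega) 0 = u from hp₀.2.1] at h
      exact h
    have hB : (B.ncard : ℝ) ≤ (L * t) ^ (s - i - 1) := by
      have h := (hp₀.1.isGood_subpath i (s - i) (by omega) (by omega) (by omega)).ncard_le
      rw [hlast, hp₀.2.2.1, show subpath p₀ i (s - i) (by omega) 0 = x from hp₀.2.2.2] at h
      exact h
    have hle : F.ncard ≤ (A ×ˢ B).ncard := by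
      refine Set.ncard_le_ncard_of_injOn
        (fun p => (subpath p 0 i (by omega), subpath p i (s - i) (by omega))) ?_ ?_ (Set.toFinite _)
      · rintro p ⟨hp, h0, h1, h2⟩
        exact ⟨⟨(hp.isGood_subpath 0 i hi his (by omega)).1, h0, (hmid p).trans h2⟩,
          ⟨(hp.isGood_subpath i (s - i) (by omega) (by omega) (by omega)).1, h2,
            (hlast p).trans h1⟩⟩
      · intro p _ p' _ hpp
        simp only [Prod.mk.injEq] at hpp
        funext k
        rcases Nat.lt_or_ge i k with h | h
        · have := congrFun hpp.2 ⟨k - i, by omega⟩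
          simpa [subpath, show i + (k.val - i) = k by omega] using this
        · have := congrFun hpp.1 ⟨k, by omega⟩
          simpa [subpath] using this
    rw [Set.ncard_prod] at hle
    calc (F.ncard : ℝ) ≤ A.ncard * B.ncard := by exact_mod_cast hle
      _ ≤ (L * t) ^ (i - 1) * (L * t) ^ (s - i - 1) := by gcongr
      _ = (L * t) ^ (s - 2) := by
        rw [← pow_add]
        congr 1
        omega

theorem IsAdmissible.isInducedPath {V : Type*} {G : SimpleGraph V} {L t : ℝ} {s : ℕ} (hs : 2 ≤ s)
    {p : Fin (s + 1) → V} (hp : IsAdmissible G L t s p) : IsInducedPath G p := by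
  obtain ⟨s, rfl⟩ := Nat.exists_eq_add_of_le' hs
  exact hp.1

open Classical in
/-- The states are bad admissible `s`-paths from a vertex `u`, taken from a subfamily in which
every endpoint `v` retains half of the paths from `u` to `v` and every path without its last vertex
has at least `L * t` extensions. The chain alternately resamples the path given its endpoint, and
its last vertex given the rest. As `3 ≤ s`, the penultimate vertices are not adjacent to `u`. -/
theorem cycleGraph_isIndContained_of_bad_paths_of_three_le {V : Type*} [Fintype V]
    (G : SimpleGraph V)
    [DecidableRel G.Adj] {ε τ L t : ℝ} (hG : IsLocallySparse G (1 - ε) τ)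
    (hε : 0 ≤ ε) (hτ : 0 < τ) (hLt : 0 < L * t) (s j : ℕ) (hs : 3 ≤ s) (u : V)
    (hu : 2 * ((G.maxDegree : ℝ) ^ (s - 1) * (L * t)) <
      #{p : Fin (s + 1) → V | IsAdmissible G L t s p ∧ ¬ IsGood G L t s p ∧ p 0 = u})
    (hsmall : (2 * (s : ℝ) + 2 * j) ^ 2 * (ε + 2 * τ / (L * t / 2) + 1 / (L * t / 2)) < 1) :
    (SimpleGraph.cycleGraph (2 * s + 2 * j)).IsIndContained G := by
  set B : Finset (Fin (s + 1) → V) :=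
    {p | IsAdmissible G L t s p ∧ ¬ IsGood G L t s p ∧ p 0 = u} with hB
  have hBind : ∀ p ∈ B, IsInducedPath G p := fun p hp =>
    (mem_filter.1 hp).2.1.isInducedPath (by omega)
  -- every endpoint that occurs is reached by many paths in `B`, since badness of an admissible
  -- path depends on its endpoints only
  have hmany : ∀ p ∈ B, (L * t) ^ (s - 1) ≤ #{α ∈ B | α (Fin.last s) = p (Fin.last s)} := by
    intro p hp
    simp only [hB, mem_filter, mem_univ, true_and] at hp
    obtain ⟨hadm, hbad, h0⟩ := hp
    have hcount : (L * t) ^ (s - 1) < (({q : Fin (s + 1) → V | IsAdmissible G L t s q ∧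
        q 0 = p 0 ∧ q (Fin.last s) = p (Fin.last s)}.ncard : ℕ) : ℝ) := by
      by_contra! h
      exact hbad ⟨hadm, Or.inr h⟩
    refine hcount.le.trans ?_
    rw [← Set.ncard_coe_finset]
    refine Nat.cast_le.2 (Set.ncard_le_ncard ?_ (Set.toFinite _))
    rintro q ⟨hq, hq0, hq1⟩
    simp only [hB, coe_filter, mem_filter, mem_univ, true_and, Set.mem_ofPred_eq]
    refine ⟨⟨hq, fun hgood => ?_, hq0.trans h0⟩, hq1⟩
    have h := hgood.ncard_le
    rw [hq0, hq1] at h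
    exact absurd h (not_le.2 hcount)
  have hfew : ∀ i (hi : 0 < i) (his : i < s) (v x : V),
      (#{α ∈ B | α (Fin.last s) = v ∧ α ⟨i, by omega⟩ = x} : ℝ) ≤ (L * t) ^ (s - 2) := by
    intro i hi his v x
    refine le_trans ?_ (ncard_admissible_through_le (G := G) hLt.le hi his u v x)
    rw [← Set.ncard_coe_finset]
    refine Nat.cast_le.2 (Set.ncard_le_ncard ?_ (Set.toFinite _))
    intro q hq
    simp only [hB, coe_filter, mem_filter, mem_univ, true_and, Set.mem_ofPred_eq] at hq
    exact ⟨hq.1.1, hq.1.2.2, hq.2.1, hq.2.2⟩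
  -- `pre` deletes the last vertex
  let pre : (Fin (s + 1) → V) → (Fin s → V) := fun p k => p k.castSucc
  have hpre : ∀ _ : DecidableEq (Fin s → V),
      (#(B.image pre) : ℝ) ≤ (G.maxDegree : ℝ) ^ (s - 1) := by
    intro _
    obtain ⟨m, rfl⟩ : ∃ m, s = m + 1 := ⟨s - 1, by omega⟩
    have h := card_walks_le G u m
    refine le_trans (Nat.cast_le.2 (card_le_card ?_)) (by exact_mod_cast h)
    intro c hc
    obtain ⟨p, hp, rfl⟩ := mem_image.1 hc
    have hind := hBind p hp
    simp only [hB, mem_filter, mem_univ, true_and] at hp ⊢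
    refine ⟨hp.2.2, fun k => ?_⟩
    rw [hind.2, SimpleGraph.pathGraph_adj]
    simp
  obtain ⟨Q, hQB, hQne, hQlast, hQpre⟩ := exists_subset_card_fiber_ge B (fun p => p (Fin.last s))
    pre (fun v => (#{α ∈ B | α (Fin.last s) = v} : ℝ) / 2) (fun _ => L * t)
    (fun _ => by positivity) (fun _ => hLt.le) (by
      rw [← sum_div, ← Nat.cast_sum, ← card_eq_sum_card_image, sum_const, nsmul_eq_mul]
      have := mul_le_mul_of_nonneg_right
        (hpre fun a b => Classical.propDecidable (a = b)) hLt.le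
      linarith)
  have hM : 0 < L * t / 2 := by positivity
  have : Nonempty Q := hQne.to_subtype
  have hspread : ∀ i, 0 < i → i < s → IsSpread (fun ω : Q => ω.1 (Fin.last s))
      (fun ω : Q => ω.1 ⟨min i s, by omega⟩) (L * t / 2) := by
    intro i hi his
    refine isSpread_coe (key := fun p : Fin (s + 1) → V => p (Fin.last s))
      (x := fun p : Fin (s + 1) → V => p ⟨min i s, by omega⟩) fun ω hω z => ?_
    have h1 := hQlast ω hω
    have h2 := hmany ω (hQB hω)
    have h3 := hfew (min i s) (by omega) (by omega) (ω (Fin.last s)) z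
    have h4 : (#{α ∈ Q | α (Fin.last s) = ω (Fin.last s) ∧ α ⟨min i s, by omega⟩ = z} : ℝ)
        ≤ (L * t) ^ (s - 2) :=
      le_trans (Nat.cast_le.2 (card_le_card (filter_subset_filter _ hQB))) h3
    have h5 : (L * t) ^ (s - 1) = (L * t) * (L * t) ^ (s - 2) := by
      rw [← pow_succ']
      congr 1
      omega
    have h6 := mul_le_mul_of_nonneg_left h4 hM.le
    linarith
  have hmin : ∀ i, i ≤ s → min i s = i := fun i hi => min_eq_left hi
  have hRlast : ∀ ω : Q, ω.1 ⟨min s s, by omega⟩ = ω.1 (Fin.last s) := fun ω =>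
    congrArg ω.1 (Fin.ext (min_self s))
  refine cycleGraph_isIndContained_of_isSpread G hG hε hτ hM s j (by omega) u
    (fun ω : Q => fun i => ω.1 ⟨min i s, by omega⟩) ?_ ?_ ?_
    (fun ω => ω.1 ⟨min (s - 1) s, by omega⟩) ?_ ?_ (fun ω => pre ω.1) ?_ ?_ ?_ ?_ hsmall
  · intro ω
    have := hQB ω.2
    simp only [hB, mem_filter] at this
    rw [← this.2.2.2]
    congr 1
  · intro ω i hi
    rw [(hBind _ (hQB ω.2)).2, SimpleGraph.pathGraph_adj]
    simp only [hmin i hi.le, hmin (i + 1) hi]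
    simp
  · rintro ω i i' hii hi' (h | h)
    · have := Fin.ext_iff.1 ((hBind _ (hQB ω.2)).1 h)
      simp only [hmin i (by omega), hmin i' hi'] at this
      omega
    · rw [(hBind _ (hQB ω.2)).2, SimpleGraph.pathGraph_adj] at h
      simp only [hmin i (by omega), hmin i' hi'] at h
      omega
  · intro ω
    rw [(hBind _ (hQB ω.2)).2, SimpleGraph.pathGraph_adj]
    simp only [hmin s le_rfl, hmin (s - 1) (by omega)]
    omega
  · intro ω
    have h0 := hQB ω.2
    simp only [hB, mem_filter] at h0
    rw [← h0.2.2.2]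
    rintro (h | h)
    · have := Fin.ext_iff.1 ((hBind _ (hQB ω.2)).1 h)
      simp only [hmin (s - 1) (by omega), Fin.val_zero] at this
      omega
    · rw [(hBind _ (hQB ω.2)).2, SimpleGraph.pathGraph_adj] at h
      simp only [hmin (s - 1) (by omega), Fin.val_zero] at h
      omega
  · intro ω ω' h
    have := congrFun h ⟨s - 1, by omega⟩
    simpa [pre] using this
  · intro i hi his
    simpa only [hRlast] using hspread i hi his
  · simpa only [hRlast] using hspread (s - 1) (by omega) (by omega)
  · simp only [hRlast]
    refine isSpread_coe (key := pre)
      (x := fun p : Fin (s + 1) → V => p (Fin.last s)) fun ω hω z => ?_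
    have h1 := hQpre ω hω
    refine le_trans (mul_le_mul_of_nonneg_left (Nat.cast_le_one.2 (card_le_one.2 ?_)) hM.le)
      (le_trans (by linarith) h1)
    intro α hα α' hα'
    simp only [mem_filter] at hα hα'
    funext k
    refine Fin.lastCases ?_ (fun k => ?_) k
    · rw [hα.2.2, hα'.2.2]
    · exact congrFun (hα.2.1.trans hα'.2.1.symm) k

/-! ### Bad paths of length two -/

open Classical in
/-- A symmetric relation on `X` with more than `c * #X` ordered pairs has a nonempty subset of `X`
on which all degrees are at least `c / 2`: a maximizer of the number of pairs minus `c` times the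
size. -/
theorem exists_subset_degree_ge {V : Type*} (X : Finset V) (Γ : V → V → Prop)
    (hΓ : ∀ v w, Γ v w → Γ w v) (c : ℝ)
    (hX : c * #X < ∑ x ∈ X, (#{y ∈ X | Γ x y} : ℝ)) :
    ∃ Y ⊆ X, Y.Nonempty ∧ ∀ x ∈ Y, c ≤ 2 * #{y ∈ Y | Γ x y} := by
  let f : Finset V → ℝ := fun Y => ∑ x ∈ Y, (#{y ∈ Y | Γ x y} : ℝ) - c * #Y
  obtain ⟨Y, hY, hmax⟩ := X.powerset.exists_max_image f ⟨X, mem_powerset_self X⟩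
  have hYX := mem_powerset.1 hY
  refine ⟨Y, hYX, ?_, fun x hx => ?_⟩
  · by_contra hne
    have h := hmax X (mem_powerset_self X)
    rw [not_nonempty_iff_eq_empty.1 hne] at h
    simp only [f, card_empty, sum_empty] at h
    norm_num at h
    linarith
  · have h := hmax (Y.erase x) (mem_powerset.2 ((erase_subset _ _).trans hYX))
    have h1 : ∀ z, (#{y ∈ Y | Γ z y} : ℝ) = #{y ∈ Y.erase x | Γ z y} + if Γ z x then 1 else 0 := by
      intro z
      nth_rewrite 1 [← insert_erase hx]
      rw [filter_insert]
      split_ifs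
      · rw [card_insert_of_notMem (by simp)]
        push_cast
        rfl
      · simp
    have h2 : ∑ z ∈ Y, (#{y ∈ Y | Γ z y} : ℝ) = #{y ∈ Y | Γ x y} +
        (∑ z ∈ Y.erase x, (#{y ∈ Y.erase x | Γ z y} : ℝ) + #{z ∈ Y.erase x | Γ z x}) := by
      rw [← add_sum_erase Y _ hx, sum_congr rfl fun z _ => h1 z, sum_add_distrib]
      simp
    have h3 : (#{z ∈ Y.erase x | Γ z x} : ℝ) ≤ #{y ∈ Y | Γ x y} := by
      refine Nat.cast_le.2 (card_le_card fun z hz => ?_)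
      simp only [mem_filter, mem_erase] at hz ⊢
      exact ⟨hz.1.2, hΓ _ _ hz.2⟩
    have h4 : (#(Y.erase x) : ℝ) = #Y - 1 := by
      rw [card_erase_of_mem hx, Nat.cast_sub (card_pos.2 ⟨x, hx⟩)]
      simp
    simp only [f] at h
    rw [h4, h2] at h
    linarith

/-- Two vertices are linked if they are distinct, nonadjacent, and have more than `μ` common
neighbours. -/
def IsLinked {V : Type*} (G : SimpleGraph V) (μ : ℝ) (v w : V) : Prop :=
  ¬ InConflict G v w ∧ μ < ({m | G.Adj v m ∧ G.Adj w m}.ncard : ℕ)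

theorem IsLinked.symm {V : Type*} {G : SimpleGraph V} {μ : ℝ} {v w : V}
    (h : IsLinked G μ v w) : IsLinked G μ w v := by
  refine ⟨fun h' => h.1 h'.symm, ?_⟩
  have := h.2
  simp only [and_comm (a := G.Adj v _)] at this
  exact this

theorem IsLinked.lt_card {V : Type*} [Fintype V] {G : SimpleGraph V} [DecidableRel G.Adj] {μ : ℝ}
    {v w : V} (h : IsLinked G μ v w) : μ < #{m | G.Adj v m ∧ G.Adj w m} := by
  rw [← Set.ncard_coe_finset]
  simpa using h.2

open Classical in
/-- Suppose that on a set `X` of at most `D` vertices each vertex is linked to at least `a` others.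
By averaging, a vertex `p` of `X` has at least `M = a * μ / (2 * D)` neighbours `w` that have at
least `M` neighbours in `X`; this gives a bipartite graph of pairs `(p, w)` with minimum degree at
least `M`. A suitable base vertex `b` in `X` is linked to `p` and nonadjacent to `w` for a positive
proportion of these pairs. The states are the triples `(p, w, m)` with `(p, w)` such a pair and `m`
a common neighbour of `b` and `p`; the chain alternately resamples `(w, m)` given `p`, and `(p, m)`
given `w`. -/
theorem cycleGraph_isIndContained_of_linked {V : Type*} [Fintype V] (G : SimpleGraph V)
    [DecidableRel G.Adj] {ε τ μ a D : ℝ} (hG : IsLocallySparse G (1 - ε) τ)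
    (hε : 0 ≤ ε) (hτ : 0 < τ) (hμ : 0 < μ) (ha : 0 < a) (j : ℕ) (X : Finset V) (hX : X.Nonempty)
    (hXD : (#X : ℝ) ≤ D) (hD : (G.maxDegree : ℝ) ≤ D)
    (hlink : ∀ x ∈ X, a ≤ #{y ∈ X | IsLinked G μ x y}) (hτa : τ ≤ a) (hτM : τ ≤ a * μ / (2 * D))
    (hεa : ε ≤ a / (2 * D))
    (hsmall : (2 * (2 : ℕ) + 2 * (j : ℝ)) ^ 2 *
      (ε + 2 * τ / (a ^ 2 * μ / (16 * D ^ 2)) + 1 / (a ^ 2 * μ / (16 * D ^ 2))) < 1) :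
    (SimpleGraph.cycleGraph (2 * 2 + 2 * j)).IsIndContained G := by
  have hXpos : (0 : ℝ) < #X := by exact_mod_cast hX.card_pos
  have hDpos : 0 < D := hXpos.trans_le hXD
  have haX : a ≤ #X := by
    obtain ⟨x, hx⟩ := hX
    exact (hlink x hx).trans (Nat.cast_le.2 (card_filter_le _ _))
  have haD : a ≤ D := haX.trans hXD
  set M := a * μ / (2 * D) with hM
  have hMpos : 0 < M := by positivity
  have hMD : M * (2 * D) = a * μ := by rw [hM]; field_simp
  -- `w` is kept as a neighbour of `p` if it has many neighbours in `X`
  let N : V → Finset V := fun p => {w | G.Adj p w ∧ M ≤ #{v ∈ X | G.Adj w v}}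
  have hN : ∀ p ∈ X, M ≤ #(N p) := by
    intro p hp
    -- count the pairs `(v, w)` with `v` linked to `p` and `w` a common neighbour of `p` and `v`
    have h1 : a * μ ≤ ∑ v ∈ X with IsLinked G μ p v, (#{w | G.Adj p w ∧ G.Adj v w} : ℝ) := by
      calc a * μ ≤ #{v ∈ X | IsLinked G μ p v} * μ :=
            mul_le_mul_of_nonneg_right (hlink p hp) hμ.le
        _ = ∑ v ∈ X with IsLinked G μ p v, μ := by simp
        _ ≤ _ := sum_le_sum fun v hv => (mem_filter.1 hv).2.lt_card.le
    have h2 : ∑ v ∈ X with IsLinked G μ p v, (#{w | G.Adj p w ∧ G.Adj v w} : ℝ)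
        ≤ ∑ w with G.Adj p w, (#{v ∈ X | G.Adj w v} : ℝ) := by
      calc _ ≤ ∑ v ∈ X, (#{w | G.Adj p w ∧ G.Adj v w} : ℝ) :=
            sum_le_sum_of_subset_of_nonneg (filter_subset _ _) fun _ _ _ => by positivity
        _ = _ := by
            simp only [card_filter, Nat.cast_sum, sum_filter]
            rw [sum_comm]
            refine sum_congr rfl fun w _ => ?_
            split_ifs with h
            · exact sum_congr rfl fun v _ => by simp [h, G.adj_comm]
            · simp [h]
    have h3 : ∑ w with G.Adj p w, (#{v ∈ X | G.Adj w v} : ℝ)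
        ≤ ∑ w with G.Adj p w, ((if M ≤ #{v ∈ X | G.Adj w v} then D else 0) + M) := by
      refine sum_le_sum fun w _ => ?_
      split_ifs with h
      · have : (#{v ∈ X | G.Adj w v} : ℝ) ≤ #X := Nat.cast_le.2 (card_filter_le _ _)
        linarith
      · linarith
    have h4 : ∑ w with G.Adj p w, ((if M ≤ (#{v ∈ X | G.Adj w v} : ℝ) then D else 0) + M)
        = #(N p) * D + #{w | G.Adj p w} * M := by
      rw [sum_add_distrib, ← sum_filter, filter_filter]
      simp [N]
    have h5 : (#{w | G.Adj p w} : ℝ) ≤ D := by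
      refine le_trans (Nat.cast_le.2 ?_) hD
      refine le_trans (le_of_eq ?_) (G.degree_le_maxDegree p)
      rw [← G.card_neighborFinset_eq_degree]
      congr 1
      ext w
      simp
    have h6 : (#{w | G.Adj p w} : ℝ) * M ≤ D * M := mul_le_mul_of_nonneg_right h5 hMpos.le
    have h7 : M * D ≤ #(N p) * D := by linarith
    exact le_of_mul_le_mul_right h7 hDpos
  let J : Finset (V × V) := {e | e.1 ∈ X ∧ e.2 ∈ N e.1}
  have hJfst : ∀ e ∈ J, M ≤ #{f ∈ J | f.1 = e.1} := by
    intro e he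
    simp only [J, mem_filter, mem_univ, true_and] at he
    refine (hN e.1 he.1).trans (Nat.cast_le.2 ?_)
    refine card_le_card_of_injOn (fun w => (e.1, w)) ?_ ?_
    · intro w hw
      simp only [J, coe_filter, mem_filter, mem_univ, true_and, Set.mem_ofPred_eq]
      exact ⟨⟨he.1, hw⟩, trivial⟩
    · intro w _ w' _ h
      exact (Prod.mk.inj h).2
  have hJsnd : ∀ e ∈ J, M ≤ #{f ∈ J | f.2 = e.2} := by
    intro e he
    simp only [J, N, mem_filter, mem_univ, true_and] at he
    refine he.2.2.trans (Nat.cast_le.2 ?_)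
    refine card_le_card_of_injOn (fun v => (v, e.2)) ?_ ?_
    · intro v hv
      simp only [coe_filter, Set.mem_ofPred_eq] at hv
      simp only [J, N, coe_filter, mem_filter, mem_univ, true_and, Set.mem_ofPred_eq]
      exact ⟨⟨hv.1, hv.2.symm, he.2.2⟩, trivial⟩
    · intro w _ w' _ h
      exact (Prod.mk.inj h).1
  have hJsum : ∀ F : V → V → ℝ, ∑ e ∈ J, F e.1 e.2 = ∑ p ∈ X, ∑ w ∈ N p, F p w := by
    intro F
    rw [← sum_finset_product' J X N (by intro e; simp [J])]
  have hJne : J.Nonempty := by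
    obtain ⟨x, hx⟩ := hX
    have h : (0 : ℝ) < #(N x) := hMpos.trans_le (hN x hx)
    obtain ⟨w, hw⟩ := card_pos.1 (Nat.cast_pos.1 h)
    exact ⟨(x, w), by simp [J, hx, hw]⟩
  have hJpos : (0 : ℝ) < #J := by exact_mod_cast hJne.card_pos
  -- the base vertex, linked to many `p` and nonadjacent to most of the corresponding `w`
  obtain ⟨b, hb, hbJ⟩ : ∃ b ∈ X, a / (2 * D) * #J ≤
      #{e ∈ J | IsLinked G μ e.1 b ∧ ¬ G.Adj e.2 b} := by
    by_contra! hcon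
    have h1 : ∑ b ∈ X, (#{e ∈ J | IsLinked G μ e.1 b ∧ ¬ G.Adj e.2 b} : ℝ)
        < ∑ b ∈ X, a / (2 * D) * #J := sum_lt_sum_of_nonempty hX hcon
    have h2 : ∑ b ∈ X, (#{e ∈ J | IsLinked G μ e.1 b} : ℝ) ≤
        ∑ b ∈ X, (#{e ∈ J | IsLinked G μ e.1 b ∧ ¬ G.Adj e.2 b} : ℝ) +
          ∑ b ∈ X, (#{e ∈ J | G.Adj e.2 b} : ℝ) := by
      rw [← sum_add_distrib]
      refine sum_le_sum fun b _ => ?_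
      rw [← Nat.cast_add]
      refine Nat.cast_le.2 (le_trans (card_le_card ?_) (card_union_le _ _))
      intro e he
      simp only [mem_filter, mem_union] at he ⊢
      tauto
    have h3 : a * #J ≤ ∑ b ∈ X, (#{e ∈ J | IsLinked G μ e.1 b} : ℝ) := by
      have : ∑ b ∈ X, (#{e ∈ J | IsLinked G μ e.1 b} : ℝ)
          = ∑ e ∈ J, (#{b ∈ X | IsLinked G μ e.1 b} : ℝ) := by
        simp only [card_filter, Nat.cast_sum]
        exact sum_comm
      rw [this]
      calc a * #J = ∑ e ∈ J, a := by simp [mul_comm]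
        _ ≤ _ := sum_le_sum fun e he => hlink e.1 (mem_filter.1 he).2.1
    have h4 : ∑ b ∈ X, (#{e ∈ J | G.Adj e.2 b} : ℝ) ≤ ε * #X * #J := by
      have e1 : ∑ b ∈ X, (#{e ∈ J | G.Adj e.2 b} : ℝ)
          = ∑ p ∈ X, (#(G.interedges (N p) X) : ℝ) := by
        have e2 : ∑ b ∈ X, (#{e ∈ J | G.Adj e.2 b} : ℝ)
            = ∑ e ∈ J, (#{b ∈ X | G.Adj e.2 b} : ℝ) := by
          simp only [card_filter, Nat.cast_sum]
          exact sum_comm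
        rw [e2, hJsum fun _ w => (#{b ∈ X | G.Adj w b} : ℝ)]
        refine sum_congr rfl fun p _ => ?_
        rw [SimpleGraph.interedges, Rel.interedges, card_filter, sum_product]
        push_cast
        refine sum_congr rfl fun w _ => ?_
        rw [card_filter]
        push_cast
        rfl
      have e3 : (#J : ℝ) = ∑ p ∈ X, (#(N p) : ℝ) := by
        have := hJsum fun _ _ => 1
        simpa using this
      rw [e1, e3, mul_sum]
      refine sum_le_sum fun p hp => ?_
      have := hG (N p) X (hτM.trans (hN p hp)) (hτa.trans haX)
      linarith
    have h5 : ε * #X ≤ a / 2 := by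
      calc ε * #X ≤ a / (2 * D) * D := by gcongr
        _ = a / 2 := by field_simp
    have h6 : ∑ b ∈ X, a / (2 * D) * (#J : ℝ) ≤ a / 2 * #J := by
      rw [sum_const, nsmul_eq_mul]
      calc (#X : ℝ) * (a / (2 * D) * #J) ≤ D * (a / (2 * D) * #J) := by gcongr
        _ = a / 2 * #J := by field_simp
    have h7 : ε * #X * #J ≤ a / 2 * #J := mul_le_mul_of_nonneg_right h5 hJpos.le
    linarith
  set θ := a / (2 * D) with hθ
  have hθpos : 0 < θ := by positivity
  -- pass to pairs `(p, w)` where both vertices retain a proportion `θ / 4` of their degree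
  obtain ⟨Q, hQ, hQne, hQfst, hQsnd⟩ := exists_subset_card_fiber_ge
    {e ∈ J | IsLinked G μ e.1 b ∧ ¬ G.Adj e.2 b} Prod.fst Prod.snd
    (fun p => θ / 4 * #{f ∈ J | f.1 = p}) (fun w => θ / 4 * #{f ∈ J | f.2 = w})
    (fun _ => by positivity) (fun _ => by positivity) (by
      have h : ∀ g : V × V → V,
          ∑ x ∈ ({e ∈ J | IsLinked G μ e.1 b ∧ ¬ G.Adj e.2 b} : Finset (V × V)).image g,
            θ / 4 * (#{f ∈ J | g f = x} : ℝ) ≤ θ / 4 * #J := by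
        intro g
        calc _ ≤ ∑ x ∈ J.image g, θ / 4 * (#{f ∈ J | g f = x} : ℝ) :=
              sum_le_sum_of_subset_of_nonneg (image_subset_image (filter_subset _ _))
                fun _ _ _ => by positivity
          _ = θ / 4 * #J := by
              rw [← mul_sum, ← Nat.cast_sum, ← card_eq_sum_card_image]
      have h1 := h Prod.fst
      have h2 := h Prod.snd
      have h3 : 0 < θ * #J := by positivity
      linarith)
  have hQJ : ∀ e ∈ Q, e ∈ J ∧ IsLinked G μ e.1 b ∧ ¬ G.Adj e.2 b := fun e he =>
    mem_filter.1 (hQ he)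
  set M' := a ^ 2 * μ / (16 * D ^ 2) with hM'
  have hM'pos : 0 < M' := by positivity
  have hM'eq : M' = θ / 4 * M := by
    rw [hM', hθ, hM]
    field_simp
    norm_num
  have hM'μ : M' ≤ μ := by
    rw [hM', div_le_iff₀ (by positivity)]
    have : a ^ 2 ≤ D ^ 2 := by gcongr
    nlinarith
  have hQfst' : ∀ e ∈ Q, M' ≤ #{f ∈ Q | f.1 = e.1} := fun e he => by
    rw [hM'eq]
    exact (mul_le_mul_of_nonneg_left (hJfst e (hQJ e he).1) (by positivity)).trans (hQfst e he)
  have hQsnd' : ∀ e ∈ Q, M' ≤ #{f ∈ Q | f.2 = e.2} := fun e he => by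
    rw [hM'eq]
    exact (mul_le_mul_of_nonneg_left (hJsnd e (hQJ e he).1) (by positivity)).trans (hQsnd e he)
  -- the same number of connections between `p` and the base vertex is used for every `p`
  have hZ : ∀ p, ∃ Z : Finset V, IsLinked G μ p b →
      #Z = ⌈μ⌉₊ ∧ ∀ m ∈ Z, G.Adj p m ∧ G.Adj b m := by
    intro p
    by_cases h : IsLinked G μ p b
    · obtain ⟨Z, hZ, hZc⟩ := exists_subset_card_eq
        (s := ({m | G.Adj p m ∧ G.Adj b m} : Finset V)) (n := ⌈μ⌉₊) (Nat.ceil_le.2 h.lt_card.le)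
      exact ⟨Z, fun _ => ⟨hZc, fun m hm => (mem_filter.1 (hZ hm)).2⟩⟩
    · exact ⟨∅, fun h' => absurd h' h⟩
  choose Z hZ using hZ
  let Ω : Finset (Σ _ : V × V, V) := Q.sigma fun e => Z e.1
  have hcount : ∀ (A : V × V → Prop) [DecidablePred A],
      (#{ω ∈ Ω | A ω.1} : ℝ) = #{e ∈ Q | A e} * (⌈μ⌉₊ : ℝ) := by
    intro A _
    have h1 : ({ω ∈ Ω | A ω.1} : Finset (Σ _ : V × V, V))
        = ({e ∈ Q | A e} : Finset (V × V)).sigma fun e => Z e.1 := by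
      ext ω
      simp only [Ω, mem_filter, mem_sigma]
      tauto
    have h2 : ∀ e ∈ ({e ∈ Q | A e} : Finset (V × V)), #(Z e.1) = ⌈μ⌉₊ := fun e he =>
      (hZ e.1 (hQJ e (mem_filter.1 he).1).2.1).1
    rw [h1, card_sigma, sum_congr rfl h2]
    simp
  have hμceil : μ ≤ (⌈μ⌉₊ : ℝ) := Nat.le_ceil μ
  have hceilpos : (0 : ℝ) < (⌈μ⌉₊ : ℝ) := hμ.trans_le hμceil
  have hΩQ : ∀ ω ∈ Ω, ω.1 ∈ Q ∧ G.Adj ω.1.1 ω.2 ∧ G.Adj b ω.2 := by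
    intro ω hω
    obtain ⟨h1, h2⟩ := mem_sigma.1 hω
    exact ⟨h1, (hZ _ (hQJ _ h1).2.1).2 _ h2⟩
  have hΩne : Ω.Nonempty := by
    obtain ⟨e, he⟩ := hQne
    have h : 0 < #(Z e.1) := by
      rw [(hZ e.1 (hQJ e he).2.1).1]
      exact Nat.ceil_pos.2 hμ
    obtain ⟨m, hm⟩ := card_pos.1 h
    exact ⟨⟨e, m⟩, mem_sigma.2 ⟨he, hm⟩⟩
  have : Nonempty Ω := hΩne.to_subtype
  have hpair : ∀ p w, (#{e ∈ Q | e.1 = p ∧ e.2 = w} : ℝ) ≤ 1 := by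
    intro p w
    refine Nat.cast_le_one.2 (card_le_one.2 ?_)
    intro e he f hf
    simp only [mem_filter] at he hf
    exact Prod.ext (he.2.1.trans hf.2.1.symm) (he.2.2.trans hf.2.2.symm)
  refine cycleGraph_isIndContained_of_isSpread G hG hε hτ hM'pos 2 j le_rfl b
    (fun ω : Ω => fun i => if i = 0 then b else if i = 1 then ω.1.2 else ω.1.1.1) ?_ ?_ ?_
    (fun ω => ω.1.1.2) ?_ ?_ (fun ω => ω.1.1.2) (fun _ _ h => h) ?_ ?_ ?_ hsmall
  · intro ω
    simp
  · intro ω i hi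
    have h := hΩQ ω.1 ω.2
    interval_cases i
    · simpa using h.2.2
    · simpa using h.2.1.symm
  · intro ω i i' hii hi'
    obtain ⟨rfl, rfl⟩ : i = 0 ∧ i' = 2 := by omega
    have h := (hQJ _ (hΩQ ω.1 ω.2).1).2.1.1
    simpa using fun h' => h (InConflict.symm h')
  · intro ω
    have h := (hQJ _ (hΩQ ω.1 ω.2).1).1
    simp only [J, N, mem_filter, mem_univ, true_and] at h
    simpa using h.2.1
  · intro ω
    have h := hQJ _ (hΩQ ω.1 ω.2).1
    have h1 := h.1
    simp only [J, N, mem_filter, mem_univ, true_and] at h1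
    rintro (h' | h')
    · exact h.2.1.1 (Or.inr (h'.symm ▸ h1.2.1))
    · exact h.2.2 h'.symm
  · intro i hi hi2
    obtain rfl : i = 1 := by omega
    refine isSpread_coe (key := fun ω : (Σ _ : V × V, V) => ω.1.1) (x := fun ω => ω.2)
      fun ω hω z => ?_
    rw [hcount fun e => e.1 = ω.1.1]
    have h1 : (#{α ∈ Ω | α.1.1 = ω.1.1 ∧ α.2 = z} : ℝ) ≤ #{e ∈ Q | e.1 = ω.1.1} := by
      refine Nat.cast_le.2 (card_le_card_of_injOn (fun α => α.1) ?_ ?_)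
      · intro α hα
        simp only [coe_filter, Set.mem_ofPred_eq] at hα ⊢
        exact ⟨(hΩQ α hα.1).1, hα.2.1⟩
      · rintro ⟨e, m⟩ hα ⟨f, m'⟩ hβ h
        simp only [coe_filter, Set.mem_ofPred_eq] at hα hβ h
        obtain rfl := h
        rw [hα.2.2, hβ.2.2]
    rw [mul_comm]
    exact mul_le_mul h1 (hM'μ.trans hμceil) hM'pos.le (by positivity)
  · refine isSpread_coe (key := fun ω : (Σ _ : V × V, V) => ω.1.1) (x := fun ω => ω.1.2)
      fun ω hω z => ?_
    rw [hcount fun e => e.1 = ω.1.1, hcount fun e => e.1 = ω.1.1 ∧ e.2 = z]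
    have h1 := hQfst' ω.1 (hΩQ ω hω).1
    have h2 := hpair ω.1.1 z
    rw [← mul_assoc]
    refine mul_le_mul_of_nonneg_right ?_ hceilpos.le
    refine le_trans ?_ h1
    exact mul_le_of_le_one_right hM'pos.le h2
  · refine isSpread_coe (key := fun ω : (Σ _ : V × V, V) => ω.1.2) (x := fun ω => ω.1.1)
      fun ω hω z => ?_
    rw [hcount fun e => e.2 = ω.1.2, hcount fun e => e.2 = ω.1.2 ∧ e.1 = z]
    have h1 := hQsnd' ω.1 (hΩQ ω hω).1
    have h2 := hpair z ω.1.2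
    simp only [and_comm (a := Prod.fst _ = z)] at h2
    rw [← mul_assoc]
    refine mul_le_mul_of_nonneg_right ?_ hceilpos.le
    refine le_trans ?_ h1
    exact mul_le_of_le_one_right hM'pos.le h2

/-! ### Averaging over vertices, and the choice of constants -/

theorem minDegree_le_averageDegree {V : Type*} [Fintype V] [Nonempty V] (G : SimpleGraph V)
    [DecidableRel G.Adj] : (G.minDegree : ℝ) ≤ averageDegree G := by
  rw [averageDegree, le_div_iff₀ (by exact_mod_cast Fintype.card_pos), mul_comm, ← nsmul_eq_mul]
  exact card_nsmul_le_sum _ _ _ fun v _ => Nat.cast_le.2 (G.minDegree_le_degree v)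

theorem averageDegree_le_maxDegree {V : Type*} [Fintype V] [Nonempty V] (G : SimpleGraph V)
    [DecidableRel G.Adj] : averageDegree G ≤ G.maxDegree := by
  rw [averageDegree, div_le_iff₀ (by exact_mod_cast Fintype.card_pos), mul_comm, ← nsmul_eq_mul]
  exact sum_le_card_nsmul _ _ _ fun v _ => Nat.cast_le.2 (G.degree_le_maxDegree v)

/-- For `τ ≤ 1` sparseness applies to single vertices and leaves no edge. -/
theorem one_lt_of_isLocallySparse_of_adj {V : Type*} {G : SimpleGraph V} [DecidableRel G.Adj]
    {ε τ : ℝ} (hG : IsLocallySparse G (1 - ε) τ) (hε : ε < 1) {v w : V} (h : G.Adj v w) :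
    1 < τ := by
  by_contra! hτ
  have := hG {v} {w} (by simpa using hτ) (by simpa using hτ)
  have e : G.interedges {v} {w} = {(v, w)} := by
    ext ⟨a, b⟩
    simp only [SimpleGraph.mem_interedges_iff, mem_singleton, Prod.mk.injEq]
    constructor
    · rintro ⟨h1, h2, -⟩
      exact ⟨h1, h2⟩
    · rintro ⟨rfl, rfl⟩
      exact ⟨rfl, rfl, h⟩
  rw [e] at this
  simp at this
  linarith

open Classical in
/-- Pigeonhole over the vertex at position `i` of the bad admissible paths; here each path is
counted once for each of its traversals, of which there is at least one. -/
theorem exists_le_card_bad_through {V : Type*} [Fintype V] [Nonempty V] (G : SimpleGraph V)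
    {L t : ℝ} {s : ℕ} (i : Fin (s + 1)) {c : ℝ}
    (h : c * Fintype.card V ≤ ((badAdmissiblePaths G L t s).ncard : ℝ)) :
    ∃ u, c ≤ #{p : Fin (s + 1) → V | IsAdmissible G L t s p ∧ ¬ IsGood G L t s p ∧ p i = u} := by
  by_contra! hcon
  have h1 : (badAdmissiblePaths G L t s).ncard ≤
      #{p : Fin (s + 1) → V | IsAdmissible G L t s p ∧ ¬ IsGood G L t s p} := by
    rw [← Set.ncard_coe_finset]
    refine (Set.ncard_le_ncard ?_ (Set.toFinite _)).trans (Set.ncard_image_le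
      (f := fun p : Fin (s + 1) → V => (⊤ : G.Subgraph).induce (Set.range p)) (Set.toFinite _))
    rintro P ⟨p, hp, hp', rfl⟩
    exact ⟨p, by simp [hp, hp'], rfl⟩
  have h2 : (#{p : Fin (s + 1) → V | IsAdmissible G L t s p ∧ ¬ IsGood G L t s p} : ℝ) =
      ∑ u, (#{p : Fin (s + 1) → V |
        IsAdmissible G L t s p ∧ ¬ IsGood G L t s p ∧ p i = u} : ℝ) := by
    rw [card_eq_sum_card_fiberwise (f := fun p => p i) (t := univ)
      (fun _ _ => mem_coe.2 (mem_univ _))]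
    push_cast
    refine sum_congr rfl fun u _ => ?_
    rw [filter_filter]
    simp only [and_assoc]
  have h3 : ∑ u, (#{p : Fin (s + 1) → V |
        IsAdmissible G L t s p ∧ ¬ IsGood G L t s p ∧ p i = u} : ℝ)
      < ∑ _u : V, c := sum_lt_sum_of_nonempty univ_nonempty fun u _ => hcon u
  have h4 : ((badAdmissiblePaths G L t s).ncard : ℝ) ≤
      #{p : Fin (s + 1) → V | IsAdmissible G L t s p ∧ ¬ IsGood G L t s p} := Nat.cast_le.2 h1
  simp only [sum_const, card_univ, nsmul_eq_mul] at h3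
  linarith

theorem isLinked_of_bad {V : Type*} [Finite V] {G : SimpleGraph V} {L t : ℝ} {p : Fin (2 + 1) → V}
    (hp : IsAdmissible G L t 2 p) (hbad : ¬ IsGood G L t 2 p) : IsLinked G (L * t) (p 0) (p 2) := by
  have hind := hp.isInducedPath le_rfl
  refine ⟨?_, ?_⟩
  · rintro (h | h)
    · exact absurd (hind.1 h) (by decide)
    · rw [hind.2, SimpleGraph.pathGraph_adj] at h
      simp at h
  · by_contra! hcon
    refine hbad ⟨hp, Or.inr (le_trans (Nat.cast_le.2 ?_) (hcon.trans (by simp)))⟩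
    refine Set.ncard_le_ncard_of_injOn (fun q => q 1) ?_ ?_ (Set.toFinite _)
    · rintro q ⟨hq, h0, h2⟩
      have hq := hq.isInducedPath le_rfl
      have h2' : q 2 = p 2 := h2
      constructor
      · rw [← h0, hq.2, SimpleGraph.pathGraph_adj]
        simp
      · rw [← h2', hq.2, SimpleGraph.pathGraph_adj]
        simp
    · rintro q ⟨-, h0, h2⟩ q' ⟨-, h0', h2'⟩ h1
      funext k
      fin_cases k
      · exact h0.trans h0'.symm
      · exact h1
      · exact h2.trans h2'.symm

open Classical in
/-- If many bad `2`-paths have the middle vertex `m`, then many pairs of neighbours of `m` are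
linked, and the neighbourhood of `m` has a subset on which all vertices are linked to many
others. -/
theorem cycleGraph_isIndContained_of_bad_paths_of_two {V : Type*} [Fintype V]
    (G : SimpleGraph V) [DecidableRel G.Adj] {ε τ L t B D : ℝ} (hG : IsLocallySparse G (1 - ε) τ)
    (hε : 0 ≤ ε) (hτ : 0 < τ) (hLt : 0 < L * t) (hB : 0 < B) (j : ℕ)
    (hD : (G.maxDegree : ℝ) ≤ D) (hD0 : 0 < D) (m : V)
    (hm : B ≤ #{p : Fin (2 + 1) → V | IsAdmissible G L t 2 p ∧ ¬ IsGood G L t 2 p ∧ p 1 = m})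
    (hτa : τ ≤ B / (4 * D)) (hτM : τ ≤ B / (4 * D) * (L * t) / (2 * D))
    (hεa : ε ≤ B / (4 * D) / (2 * D))
    (hsmall : (2 * (2 : ℕ) + 2 * (j : ℝ)) ^ 2 *
      (ε + 2 * τ / ((B / (4 * D)) ^ 2 * (L * t) / (16 * D ^ 2)) +
        1 / ((B / (4 * D)) ^ 2 * (L * t) / (16 * D ^ 2))) < 1) :
    (SimpleGraph.cycleGraph (2 * 2 + 2 * j)).IsIndContained G := by
  have hXD : (#(G.neighborFinset m) : ℝ) ≤ D := by
    refine le_trans (Nat.cast_le.2 ?_) hD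
    rw [G.card_neighborFinset_eq_degree]
    exact G.degree_le_maxDegree m
  obtain ⟨Y, hYX, hY, hdeg⟩ := exists_subset_degree_ge (G.neighborFinset m) (IsLinked G (L * t))
    (fun _ _ => IsLinked.symm) (B / (2 * D)) (by
      have h1 : B / (2 * D) * #(G.neighborFinset m) ≤ B / 2 := by
        calc _ ≤ B / (2 * D) * D := by gcongr
          _ = B / 2 := by field_simp
      have h2 : B ≤ ∑ x ∈ G.neighborFinset m,
          (#{y ∈ G.neighborFinset m | IsLinked G (L * t) x y} : ℝ) := by
        refine hm.trans ?_
        rw [← Nat.cast_sum, ← card_sigma]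
        refine Nat.cast_le.2 (card_le_card_of_injOn (fun p => ⟨p 0, p 2⟩) ?_ ?_)
        · intro p hp
          simp only [coe_filter, mem_univ, true_and, Set.mem_ofPred_eq] at hp
          have hind := hp.1.isInducedPath le_rfl
          have h0 : G.Adj m (p 0) := by
            rw [← hp.2.2, hind.2, SimpleGraph.pathGraph_adj]
            simp
          have h2 : G.Adj m (p 2) := by
            rw [← hp.2.2, hind.2, SimpleGraph.pathGraph_adj]
            simp
          simp only [mem_coe, mem_sigma, mem_filter, SimpleGraph.mem_neighborFinset]
          exact ⟨h0, h2, isLinked_of_bad hp.1 hp.2.1⟩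
        · intro p hp q hq h
          simp only [coe_filter, mem_univ, true_and, Set.mem_ofPred_eq] at hp hq
          simp only [Sigma.mk.injEq, heq_eq_eq] at h
          funext k
          fin_cases k
          · exact h.1
          · exact hp.2.2.trans hq.2.2.symm
          · exact h.2
      linarith)
  refine cycleGraph_isIndContained_of_linked G hG hε hτ hLt (a := B / (4 * D)) (D := D)
    (by positivity) j Y hY (le_trans (Nat.cast_le.2 (card_le_card hYX)) hXD) hD (fun x hx => ?_)
    hτa hτM hεa hsmall
  have := hdeg x hx
  have e : B / (2 * D) = 2 * (B / (4 * D)) := by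
    field_simp
    norm_num
  linarith

/-- The hierarchy is used in the form `1 / ε ≤ β`, `β ^ 3 ≤ L`, `L ^ 3 ≤ C`, with `1 / ε` larger
than every power of `4 * K` that occurs. -/
theorem cycleGraph_isIndContained_of_bad {V : Type*} [Fintype V] (G : SimpleGraph V)
    [DecidableRel G.Adj] {C L β ε K t : ℝ} {ℓ s : ℕ} (hε : 0 < ε) (hK : 0 < K) (ht : 0 < t)
    (hεQ : ε * (4 * K) ^ (4 * ℓ + 5) ≤ 1) (hβ : 1 ≤ ε * β) (hL : β ^ 3 ≤ L)
    (hC : L ^ 3 ≤ C) (hreg : IsAlmostRegular G K) (hG : IsLocallySparse G (1 - ε) (β * t))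
    (hd : 2 * C * t ≤ averageDegree G) (hs : 2 ≤ s) (hsℓ : s ≤ ℓ)
    (hbad : 1 / 2 * (1 / (4 * K)) ^ (2 * ℓ - s) * (Fintype.card V : ℝ) * averageDegree G ^ s
      ≤ ((badAdmissiblePaths G L t s).ncard : ℝ)) :
    (SimpleGraph.cycleGraph (2 * ℓ)).IsIndContained G := by
  have hβ0 : 0 < β := by
    by_contra! h
    nlinarith
  have hL0 : 0 < L := lt_of_lt_of_le (by positivity) hL
  have hC0 : 0 < C := lt_of_lt_of_le (by positivity) hC
  have hLt : 0 < L * t := by positivity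
  set d := averageDegree G with hd_def
  have hd0 : 0 < d := lt_of_lt_of_le (by positivity) hd
  have : Nonempty V := by
    by_contra h
    rw [not_nonempty_iff] at h
    have : d = 0 := by simp [hd_def, averageDegree]
    linarith
  have hdmax : d ≤ G.maxDegree := averageDegree_le_maxDegree G
  have hΔ : (G.maxDegree : ℝ) ≤ K * d :=
    hreg.trans (mul_le_mul_of_nonneg_left (minDegree_le_averageDegree G) hK.le)
  have hK1 : 1 ≤ K := by
    have h := hreg.trans (mul_le_mul_of_nonneg_left
      (Nat.cast_le.2 (G.minDegree_le_maxDegree)) hK.le)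
    by_contra! h'
    have h0 : (0 : ℝ) < G.maxDegree := hd0.trans_le hdmax
    nlinarith
  set x := 4 * K with hx
  have hx4 : 4 ≤ x := by linarith
  have hx0 : 0 < x := by linarith
  have hpow : ∀ k ≤ 4 * ℓ + 5, ε * x ^ k ≤ 1 := fun k hk =>
    (mul_le_mul_of_nonneg_left (pow_le_pow_right₀ (by linarith) hk) hε.le).trans hεQ
  have hpowβ : ∀ k ≤ 4 * ℓ + 5, x ^ k ≤ β := by
    intro k hk
    calc x ^ k ≤ x ^ k * (ε * β) := le_mul_of_one_le_right (by positivity) hβ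
      _ = ε * x ^ k * β := by ring
      _ ≤ β := mul_le_of_le_one_left hβ0.le (hpow k hk)
  have hβ1 : 1 ≤ β := by simpa using hpowβ 0 (by omega)
  have hβ2L : β ^ 2 ≤ L := (pow_le_pow_right₀ hβ1 (by omega)).trans hL
  have hβL : β ≤ L := (le_self_pow₀ hβ1 (by omega)).trans hβ2L
  have hL1 : 1 ≤ L := hβ1.trans hβL
  have hL2C : L ^ 2 ≤ C := (pow_le_pow_right₀ hL1 (by omega)).trans hC
  have hLC : L ≤ C := (le_self_pow₀ hL1 (by omega)).trans hL2C
  have hεx : ε * 4 ≤ 1 := by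
    have := hpow 1 (by omega)
    rw [pow_one] at this
    nlinarith
  have hτ1 : 1 < β * t := by
    have hne : ∃ v w, G.Adj v w := by
      obtain ⟨v, hv⟩ := G.exists_maximal_degree_vertex
      have : 0 < G.degree v := by
        rw [← hv]
        exact_mod_cast hd0.trans_le hdmax
      obtain ⟨w, hw⟩ := (G.degree_pos_iff_exists_adj v).1 this
      exact ⟨v, w, hw⟩
    obtain ⟨v, w, h⟩ := hne
    exact one_lt_of_isLocallySparse_of_adj hG (by linarith) h
  have hτ0 : 0 < β * t := by positivity
  have hℓ2 : (2 * (ℓ : ℝ)) ^ 2 * (4 * ε) < 1 := by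
    have h1 : (ℓ : ℝ) ≤ 2 ^ ℓ := by exact_mod_cast Nat.lt_two_pow_self.le
    have h2 : (ℓ : ℝ) ^ 2 ≤ x ^ ℓ := by
      calc (ℓ : ℝ) ^ 2 ≤ (2 ^ ℓ) ^ 2 := by gcongr
        _ = 4 ^ ℓ := by rw [← pow_mul, mul_comm, pow_mul]; norm_num
        _ ≤ x ^ ℓ := by gcongr
    have h3 : (64 : ℝ) ≤ x ^ 3 := by
      calc (64 : ℝ) = 4 ^ 3 := by norm_num
        _ ≤ x ^ 3 := by gcongr
    have h4 := hpow (ℓ + 3) (by omega)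
    have h5 : (ℓ : ℝ) ^ 2 * 64 ≤ x ^ (ℓ + 3) := by
      rw [pow_add]
      gcongr
    have h6 := mul_le_mul_of_nonneg_left h5 hε.le
    nlinarith
  -- spreading over at least `ε * (L * t)` vertices is enough
  have hsmall : ∀ M, ε * (L * t) ≤ M →
      (2 * (ℓ : ℝ)) ^ 2 * (ε + 2 * (β * t) / M + 1 / M) < 1 := by
    intro M hM
    have hM0 : 0 < M := lt_of_lt_of_le (by positivity) hM
    have h1 : β * t / M ≤ ε := by
      rw [div_le_iff₀ hM0]
      have h2 : β ≤ ε * (ε * L) := by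
        calc β ≤ (ε * β) * (ε * β) * β := by
              have := one_le_mul_of_one_le_of_one_le hβ hβ
              exact le_mul_of_one_le_left hβ0.le this
          _ = ε * (ε * β ^ 3) := by ring
          _ ≤ ε * (ε * L) := by gcongr
      calc β * t ≤ ε * (ε * L) * t := by gcongr
        _ = ε * (ε * (L * t)) := by ring
        _ ≤ ε * M := by gcongr
    have h2 : 1 / M ≤ β * t / M := by gcongr
    have h3 : ε + 2 * (β * t) / M + 1 / M ≤ 4 * ε := by
      rw [mul_div_assoc]
      linarith
    exact lt_of_le_of_lt (mul_le_mul_of_nonneg_left h3 (by positivity)) hℓ2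
  set c := 1 / 2 * (1 / x) ^ (2 * ℓ - s) with hc
  have hc0 : 0 < c := by positivity
  have hcx : 1 ≤ 2 * c * x ^ (2 * ℓ) := by
    have h1 : x ^ (2 * ℓ - s) ≤ x ^ (2 * ℓ) := pow_le_pow_right₀ (by linarith) (by omega)
    have h2 : 2 * c * x ^ (2 * ℓ - s) = 1 := by
      rw [hc, one_div_pow]
      field_simp
    calc (1 : ℝ) = 2 * c * x ^ (2 * ℓ - s) := h2.symm
      _ ≤ _ := by gcongr
  have hcd : 2 * (c * C) * t ≤ c * d := by
    have := mul_le_mul_of_nonneg_left hd hc0.le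
    linarith
  obtain ⟨j, rfl⟩ := Nat.exists_eq_add_of_le hsℓ
  rw [mul_add]
  have hbad' : c * d ^ s * Fintype.card V ≤ ((badAdmissiblePaths G L t s).ncard : ℝ) := by
    refine le_trans (le_of_eq ?_) hbad
    ring
  rcases hs.lt_or_eq with hs3 | rfl
  · obtain ⟨u, hu⟩ := exists_le_card_bad_through G 0 hbad'
    refine cycleGraph_isIndContained_of_bad_paths_of_three_le G hG hε.le hτ0 hLt s j hs3 u
      (lt_of_lt_of_le ?_ hu) ?_
    · have h1 : K ^ (s - 1) * L < c * C := by
        have hKx : K ^ (s - 1) ≤ x ^ (s + j) := by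
          calc K ^ (s - 1) ≤ x ^ (s - 1) := by
                gcongr
                linarith
            _ ≤ x ^ (s + j) := pow_le_pow_right₀ (by linarith) (by omega)
        calc K ^ (s - 1) * L ≤ x ^ (s + j) * L * (2 * c * x ^ (2 * (s + j))) := by
              refine le_trans ?_ (le_mul_of_one_le_right (by positivity) hcx)
              gcongr
          _ = 2 * (c * x ^ (3 * (s + j)) * L) := by ring
          _ < x * (c * x ^ (3 * (s + j)) * L) := by
              have : 0 < c * x ^ (3 * (s + j)) * L := by positivity
              gcongr
              linarith
          _ = c * x ^ (3 * (s + j) + 1) * L := by ring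
          _ ≤ c * β * L := by
              have := hpowβ (3 * (s + j) + 1) (by omega)
              gcongr
          _ ≤ c * L * L := by gcongr
          _ = c * L ^ 2 := by ring
          _ ≤ c * C := by gcongr
      have h2 : (G.maxDegree : ℝ) ^ (s - 1) ≤ K ^ (s - 1) * d ^ (s - 1) := by
        rw [← mul_pow]
        gcongr
      have hdp : 0 < d ^ (s - 1) := by positivity
      calc 2 * ((G.maxDegree : ℝ) ^ (s - 1) * (L * t))
          ≤ 2 * (K ^ (s - 1) * d ^ (s - 1) * (L * t)) := by gcongr
        _ = 2 * (K ^ (s - 1) * L) * t * d ^ (s - 1) := by ring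
        _ < 2 * (c * C) * t * d ^ (s - 1) := by gcongr
        _ ≤ c * d * d ^ (s - 1) := by gcongr
        _ = c * d ^ s := by
          rw [mul_assoc, ← pow_succ']
          congr 2
          omega
    · have := hsmall (L * t / 2) (by nlinarith)
      push_cast at this
      rw [mul_add (2 : ℝ)] at this
      exact this
  · obtain ⟨m, hm⟩ := exists_le_card_bad_through G 1 hbad'
    have hd' : d ≠ 0 := hd0.ne'
    have hK' : K ≠ 0 := hK.ne'
    have e1 : c * d ^ 2 / (4 * (K * d)) = c * d / x := by
      rw [hx]
      field_simp
    have e2 : c * d / x * (L * t) / (2 * (K * d)) = 2 * c * (L * t) / x ^ 2 := by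
      rw [hx]
      field_simp
      norm_num
    have e3 : c * d / x / (2 * (K * d)) = 2 * c / x ^ 2 := by
      rw [hx]
      field_simp
      norm_num
    have e4 : (c * d / x) ^ 2 * (L * t) / (16 * (K * d) ^ 2) = c ^ 2 * (L * t) / x ^ 4 := by
      rw [hx]
      field_simp
      norm_num
    refine cycleGraph_isIndContained_of_bad_paths_of_two G hG hε.le hτ0 hLt
      (B := c * d ^ 2) (D := K * d) (by positivity) j hΔ (by positivity) m hm ?_ ?_ ?_ ?_
    · rw [e1, le_div_iff₀ hx0]
      refine le_trans ?_ hcd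
      have h1 : β * x ≤ 2 * (c * C) := by
        calc β * x ≤ β * x * (2 * c * x ^ (2 * (2 + j))) :=
              le_mul_of_one_le_right (by positivity) hcx
          _ = 2 * (c * (β * x ^ (2 * (2 + j) + 1))) := by ring
          _ ≤ 2 * (c * (β * β)) := by
              have := hpowβ (2 * (2 + j) + 1) (by omega)
              gcongr
          _ = 2 * (c * β ^ 2) := by ring
          _ ≤ 2 * (c * C) := by
              have := hβ2L.trans hLC
              gcongr
      calc β * t * x = β * x * t := by ring
        _ ≤ _ := by gcongr
    · rw [e1, e2, le_div_iff₀ (by positivity)]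
      have h1 : β * x ^ 2 ≤ 2 * c * L := by
        calc β * x ^ 2 ≤ β * x ^ 2 * (2 * c * x ^ (2 * (2 + j))) :=
              le_mul_of_one_le_right (by positivity) hcx
          _ = 2 * c * (β * x ^ (2 * (2 + j) + 2)) := by ring
          _ ≤ 2 * c * (β * β) := by
              have := hpowβ (2 * (2 + j) + 2) (by omega)
              gcongr
          _ = 2 * c * β ^ 2 := by ring
          _ ≤ 2 * c * L := by gcongr
      calc β * t * x ^ 2 = β * x ^ 2 * t := by ring
        _ ≤ 2 * c * L * t := by gcongr
        _ = _ := by ring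
    · rw [e1, e3, le_div_iff₀ (by positivity)]
      calc ε * x ^ 2 ≤ ε * x ^ 2 * (2 * c * x ^ (2 * (2 + j))) :=
            le_mul_of_one_le_right (by positivity) hcx
        _ = 2 * c * (ε * x ^ (2 * (2 + j) + 2)) := by ring
        _ ≤ 2 * c * 1 := by
            have := hpow (2 * (2 + j) + 2) (by omega)
            gcongr
        _ = 2 * c := mul_one _
    · rw [e1, e4]
      have h1 : ε * x ^ 4 ≤ c ^ 2 := by
        calc ε * x ^ 4 ≤ ε * x ^ 4 * ((2 * c * x ^ (2 * (2 + j))) * (2 * c * x ^ (2 * (2 + j)))) :=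
              le_mul_of_one_le_right (by positivity)
                (one_le_mul_of_one_le_of_one_le hcx hcx)
          _ = c ^ 2 * (4 * (ε * x ^ (4 * (2 + j) + 4))) := by ring
          _ ≤ c ^ 2 * (x * (ε * x ^ (4 * (2 + j) + 4))) := by gcongr
          _ = c ^ 2 * (ε * x ^ (4 * (2 + j) + 5)) := by ring
          _ ≤ c ^ 2 * 1 := by gcongr
          _ = c ^ 2 := mul_one _
      have := hsmall (c ^ 2 * (L * t) / x ^ 4) (by
        rw [le_div_iff₀ (by positivity)]
        calc ε * (L * t) * x ^ 4 = ε * x ^ 4 * (L * t) := by ring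
          _ ≤ _ := by gcongr)
      push_cast at this ⊢
      rw [mul_add (2 : ℝ)] at this
      exact this

theorem lemma3p4 :
    ∃ (f₁ f₂ f₃ : ℝ → ℝ) (f₄ : ℝ → ℝ → ℝ),
      IsHierarchyFun f₁ ∧ IsHierarchyFun f₂ ∧ IsHierarchyFun f₃ ∧ IsHierarchyFun₂ f₄ ∧
      ∀ (C L β ε K : ℝ) (ℓ : ℕ),
        0 < C → 0 < L → 0 < β → 0 < ε → 0 < K → 0 < ℓ →
        1 / C ≤ f₁ (1 / L) → 1 / L ≤ f₂ (1 / β) → 1 / β ≤ f₃ ε →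
        ε ≤ f₄ (1 / K) (1 / (ℓ : ℝ)) →
        ∀ (V : Type*) [Fintype V] (G : SimpleGraph V) [DecidableRel G.Adj] (t : ℝ),
          0 < t →
          IsAlmostRegular G K →
          IsLocallySparse G (1 - ε) (β * t) →
          2 * C * t ≤ averageDegree G →
          ∀ s : ℕ, 2 ≤ s → s ≤ ℓ →
            1 / 2 * (1 / (4 * K)) ^ (2 * ℓ - s) * (Fintype.card V : ℝ) * averageDegree G ^ s
              ≤ ((badAdmissiblePaths G L t s).ncard : ℝ) →
            (SimpleGraph.cycleGraph (2 * ℓ)).IsIndContained G := by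
  have hcube : IsHierarchyFun fun x => x ^ 3 :=
    ⟨fun x hx y _ hxy => pow_le_pow_left₀ (le_of_lt hx) hxy 3, fun y hy => pow_pos hy 3⟩
  refine ⟨fun x => x ^ 3, fun x => x ^ 3, fun x => x,
    fun x y => Real.exp (-(20 * (1 / x) * (1 / y + 1))), hcube, hcube,
    ⟨monotoneOn_id, fun _ h => h⟩,
    ⟨fun y y' z z' hy hyy hz hzz => ?_, fun _ _ _ _ => Real.exp_pos _⟩, ?_⟩
  · have hy' : 0 < y' := hy.trans_le hyy
    have hz' : 0 < z' := hz.trans_le hzz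
    refine Real.exp_le_exp.2 (neg_le_neg ?_)
    gcongr
  · intro C L β ε K ℓ hC hL hβ hε hK hℓ h1 h2 h3 h4 V _ G _ t ht hreg hG hd s hs hsℓ hbad
    beta_reduce at h1 h2 h3 h4
    rw [one_div_pow, one_div_le_one_div hC (by positivity)] at h1
    rw [one_div_pow, one_div_le_one_div hL (by positivity)] at h2
    rw [div_le_iff₀ hβ] at h3
    refine cycleGraph_isIndContained_of_bad G hε hK ht ?_ h3 h2 h1 hreg hG hd hs hsℓ
      hbad
    simp only [one_div_one_div] at h4
    have h5 : (4 * K) ^ (4 * ℓ + 5) ≤ Real.exp (20 * K * (ℓ + 1)) := by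
      calc (4 * K) ^ (4 * ℓ + 5) ≤ Real.exp (4 * K) ^ (4 * ℓ + 5) := by
            gcongr
            linarith [Real.add_one_le_exp (4 * K)]
        _ = Real.exp ((4 * ℓ + 5 : ℕ) * (4 * K)) := (Real.exp_nat_mul _ _).symm
        _ ≤ Real.exp (20 * K * (ℓ + 1)) := by
            refine Real.exp_le_exp.2 ?_
            push_cast
            have : 0 ≤ K * ℓ := by positivity
            nlinarith
    calc ε * (4 * K) ^ (4 * ℓ + 5)
        ≤ Real.exp (-(20 * K * (ℓ + 1))) * Real.exp (20 * K * (ℓ + 1)) := by gcongr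
      _ = 1 := by rw [← Real.exp_add]; simp
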